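/- All manifolds are real, smooth, finite-dimensional, Hausdorff and second countable. A smooth map $F:\mathcal M\to\mathcal N$ is called a locally trivial bundle if locally on $\mathcal M$ it is a trivial bundle, i.e. around every $p\in\mathcal M$ and $F(p)$ there are charts in which $F$ is a linear projection $\mathbb R^{n+k}\to\mathbb R^{n}$. For such an $F$ let $A=C^\infty(\mathcal M)$, let $\mathfrak X^1(\mathcal M)$ be the $A$-module of vector fields on $\mathcal M$ and $\mathfrak X^1(F)\subseteq\mathfrak X^1(\mathcal M)$ the Lie subalgebra of vector fields tangent to the fibres of $F$. Let $\mathcal R(F)=\mathcal R(\mathfrak X^1(\mathcal M),\mathfrak X^1(F))$ be the relatively free Lie–Rinehart algebra over $A$: it is generated, as a Lie–Rinehart algebra with bracket $\llbracket-,-\rrbracket$, by the $A$-module $\mathfrak X^1(\mathcal M)$ with its action on $A$, subject to the relations $\llbracket\gamma,\xi\rrbracket=[\gamma,\xi]$ for $\gamma\in\mathfrak X^1(F)$, $\xi\in\mathfrak X^1(\mathcal M)$. It is filtered by the $A$-submodules $\mathcal R(F)_{\le d}$ spanned by brackets of at most $d$ vector fields. The bundle $\mathcal{RT}_{\mathcal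 N}\mathcal M\to\mathcal M$ of $F$-horizontal infinitesimal paths is the (filtered) linear bundle with module of sections $\mathcal R(F)$; its fibre at $p$ is $\mathcal R(F)/\mathfrak m_p\mathcal R(F)$, where $\mathfrak m_p\subset A$ is the ideal of functions vanishing at $p$. A map from a Euclidean space to $\mathcal{RT}_{\mathcal N}\mathcal M$ is smooth if its projection to $\mathcal M$ is smooth and if locally it is a finite sum $u\mapsto\sum_i g_i(u)\,s_i(p(u))$ with $g_i$ smooth, $s_i\in\mathcal R(F)$ and $p(u)$ the projection to $\mathcal M$; a map between such bundles is smooth if it takes smooth maps from Euclidean spaces to smooth maps. **Proposition.** To every commutative square $$\begin{array}{ccc}\mathcal M_1&\xrightarrow{\ \varphi\ }&\mathcal M_2\\ {\scriptstyle F_1}\downarrow&&\downarrow{\scriptstyle F_2}\\ \mathcal N_1&\xrightarrow{\ \psi\ }&\mathcal N_2\end{array}$$ of smooth maps, in which $F_1,F_2$ and also $\varphi,\psi$ are locally trivial bundles, one can associate a smooth, fibrewise $\mathbb R$-linear map $$\mathcal{RT}(\varphi,\psi):\ \mathcal{RT}_{\mathcal N_1}\mathcal M_1\to\mathcal{RT}_{\mathcal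 N_2}\mathcal M_2$$ over $\varphi$ that is induced by the square in the following sense: it preserves the filtrations; it extends the differential of $\varphi$, i.e. it takes the value at $p$ of $\xi\in\mathfrak X^1(\mathcal M_1)$ to the value at $\varphi(p)$ of $\eta\in\mathfrak X^1(\mathcal M_2)$ whenever $d\varphi_p(\xi_p)=\eta_{\varphi(p)}$; and if $\xi_1,\dots,\xi_k\in\mathfrak X^1(\mathcal M_1)$ are $\varphi$-related, near a point $p$, to $\eta_1,\dots,\eta_k\in\mathfrak X^1(\mathcal M_2)$, then it takes the value at $p$ of every real linear combination of iterated brackets of the $\xi_i$ in $\mathcal R(F_1)$ to the value at $\varphi(p)$ of the same combination of iterated brackets of the $\eta_i$ in $\mathcal R(F_2)$. The assignment is functorial in the square: the identity square goes to the identity map, and the horizontal composite of two squares goes to the composite of their maps. -/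

import Mathlib

open scoped Manifold ContDiff Topology

universe u v

/-! ## Anchored modules and relatively free Lie–Rinehart algebras -/

/-- An anchored `(𝔤, A)`-module for a Lie–Rinehart algebra `𝔤` over the commutative `k`-algebra `A`:
an `A`-module `M` with `A`-linear maps `ι : 𝔤 → M` (injective) and `b : M → Der_k A`, such that
`b ∘ ι` is the anchor of `𝔤`, and with a Lie action of `𝔤` on `M` (the instance
`LieRingModule 𝔤 M`) compatible with this structure. -/
class AnchoredModule (k A 𝔤 M : Type*) [CommRing k] [CommRing A] [Algebra k A]
    [LieRing 𝔤] [Module A 𝔤] [LieRingModule 𝔤 A] [LieRinehartRing A 𝔤]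
    [LieAlgebra k 𝔤] [LieRinehartAlgebra k A 𝔤]
    [AddCommGroup M] [Module A M] [LieRingModule 𝔤 M] where
  incl : 𝔤 →ₗ[A] M
  anchor : M →ₗ[A] Derivation k A A
  incl_injective : Function.Injective incl
  anchor_incl : ∀ γ : 𝔤, anchor (incl γ) = LieRinehartAlgebra.anchor k A 𝔤 γ
  lie_smul : ∀ (γ : 𝔤) (f : A) (m : M), ⁅γ, f • m⁆ = ⁅γ, f⁆ • m + f • ⁅γ, m⁆
  smul_lie : ∀ (f : A) (γ : 𝔤) (m : M), ⁅f • γ, m⁆ = f • ⁅γ, m⁆ - anchor m f • incl γ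
  anchor_lie : ∀ (γ : 𝔤) (m : M),
    anchor ⁅γ, m⁆ = ⁅LieRinehartAlgebra.anchor k A 𝔤 γ, anchor m⁆

/-- Formal expressions built from generators `m : M` by addition, multiplication with elements of
`A`, and a bracket. -/
inductive LRTerm (A M : Type*) : Type _
  | of : M → LRTerm A M
  | zero : LRTerm A M
  | add : LRTerm A M → LRTerm A M → LRTerm A M
  | smul : A → LRTerm A M → LRTerm A M
  | lie : LRTerm A M → LRTerm A M → LRTerm A M

section RelFree

variable (k A 𝔤 M : Type*) [CommRing k] [CommRing A] [Algebra k A]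
  [LieRing 𝔤] [Module A 𝔤] [LieRingModule 𝔤 A] [LieRinehartRing A 𝔤]
  [LieAlgebra k 𝔤] [LieRinehartAlgebra k A 𝔤]
  [AddCommGroup M] [Module A M] [LieRingModule 𝔤 M] [AnchoredModule k A 𝔤 M]

/-- The action on `A` of a formal expression. -/
noncomputable def LRTerm.anchor : LRTerm A M → Derivation k A A
  | .of m => AnchoredModule.anchor 𝔤 m
  | .zero => 0
  | .add x y => LRTerm.anchor x + LRTerm.anchor y
  | .smul f x => f • LRTerm.anchor x
  | .lie x y => ⁅LRTerm.anchor x, LRTerm.anchor y⁆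

/-- The relations of the relatively free Lie–Rinehart algebra. The constructors up to `leibniz`
are the axioms of a Lie–Rinehart algebra (the equality `[x, f y] = f [x, y] + x(f) y` and
antisymmetry contain `[x, f y] - [f x, y] = x(f) y + y(f) x`), `of_add` and `of_smul` make
`M → R(M, 𝔤)` an `A`-linear map, and `of_lie` is the relation `[ι(γ), m] = γ(m)`. -/
inductive RelFree.Rel : LRTerm A M → LRTerm A M → Prop
  | add_congr_left {x x'} (y) : Rel x x' → Rel (.add x y) (.add x' y)
  | add_congr_right (x) {y y'} : Rel y y' → Rel (.add x y) (.add x y')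
  | smul_congr (f) {x x'} : Rel x x' → Rel (.smul f x) (.smul f x')
  | lie_congr_left {x x'} (y) : Rel x x' → Rel (.lie x y) (.lie x' y)
  | lie_congr_right (x) {y y'} : Rel y y' → Rel (.lie x y) (.lie x y')
  | add_comm (x y) : Rel (.add x y) (.add y x)
  | add_assoc (x y z) : Rel (.add (.add x y) z) (.add x (.add y z))
  | zero_add (x) : Rel (.add .zero x) x
  | smul_add (f x y) : Rel (.smul f (.add x y)) (.add (.smul f x) (.smul f y))
  | add_smul (f g x) : Rel (.smul (f + g) x) (.add (.smul f x) (.smul g x))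
  | mul_smul (f g x) : Rel (.smul (f * g) x) (.smul f (.smul g x))
  | one_smul (x) : Rel (.smul 1 x) x
  | zero_smul (x) : Rel (.smul 0 x) .zero
  | add_lie (x y z) : Rel (.lie (.add x y) z) (.add (.lie x z) (.lie y z))
  | lie_add (x y z) : Rel (.lie x (.add y z)) (.add (.lie x y) (.lie x z))
  | lie_self (x) : Rel (.lie x x) .zero
  | jacobi (x y z) :
      Rel (.lie x (.lie y z)) (.add (.lie (.lie x y) z) (.lie y (.lie x z)))
  | leibniz (x) (f : A) (y) :
      Rel (.lie x (.smul f y)) (.add (.smul f (.lie x y)) (.smul (LRTerm.anchor k A 𝔤 M x f) y))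
  | of_add (m n : M) : Rel (.of (m + n)) (.add (.of m) (.of n))
  | of_smul (f : A) (m : M) : Rel (.of (f • m)) (.smul f (.of m))
  | of_lie (γ : 𝔤) (m : M) :
      Rel (.lie (.of (AnchoredModule.incl k (A := A) (M := M) γ)) (.of m)) (.of ⁅γ, m⁆)

/-- The relatively free Lie–Rinehart algebra `R(M, 𝔤)` on an anchored `(𝔤, A)`-module `M`: the
Lie–Rinehart algebra over `A` generated by the anchored module `M`, subject to
`[ι(γ), m] = γ(m)`. See `RelFree.lift` for its universal property. -/
def RelFree : Type _ := Quot (RelFree.Rel k A 𝔤 M)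

namespace RelFree

instance : Add (RelFree k A 𝔤 M) :=
  ⟨Quot.map₂ .add (fun x _ _ h => .add_congr_right x h) (fun _ _ y h => .add_congr_left y h)⟩

instance : Zero (RelFree k A 𝔤 M) := ⟨Quot.mk _ .zero⟩

noncomputable instance : Neg (RelFree k A 𝔤 M) :=
  ⟨Quot.map (.smul (-1)) (fun _ _ h => .smul_congr _ h)⟩

noncomputable instance : AddCommGroup (RelFree k A 𝔤 M) where
  nsmul := nsmulRec
  zsmul := zsmulRec
  add_assoc := by rintro ⟨x⟩ ⟨y⟩ ⟨z⟩; exact Quot.sound (.add_assoc x y z)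
  add_comm := by rintro ⟨x⟩ ⟨y⟩; exact Quot.sound (.add_comm x y)
  zero_add := by rintro ⟨x⟩; exact Quot.sound (.zero_add x)
  add_zero := by
    rintro ⟨x⟩
    exact (Quot.sound (.add_comm x .zero)).trans (Quot.sound (.zero_add x))
  neg_add_cancel := by
    rintro ⟨x⟩
    change Quot.mk _ (LRTerm.add (.smul (-1) x) x) = Quot.mk _ .zero
    rw [← Quot.sound (Rel.zero_smul x), ← neg_add_cancel (1 : A), Quot.sound (Rel.add_smul _ _ x)]
    exact (Quot.sound (.add_congr_right _ (.one_smul x))).symm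

noncomputable instance : Module A (RelFree k A 𝔤 M) where
  smul f := Quot.map (.smul f) (fun _ _ h => .smul_congr f h)
  one_smul := by rintro ⟨x⟩; exact Quot.sound (.one_smul x)
  mul_smul := by rintro f g ⟨x⟩; exact Quot.sound (.mul_smul f g x)
  smul_zero := by
    intro f
    change Quot.mk _ (LRTerm.smul f .zero) = Quot.mk _ .zero
    rw [← Quot.sound (Rel.smul_congr f (.zero_smul .zero)), ← Quot.sound (Rel.mul_smul f 0 _),
      mul_zero]
    exact Quot.sound (.zero_smul _)
  smul_add := by rintro f ⟨x⟩ ⟨y⟩; exact Quot.sound (.smul_add f x y)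
  add_smul := by rintro f g ⟨x⟩; exact Quot.sound (.add_smul f g x)
  zero_smul := by rintro ⟨x⟩; exact Quot.sound (.zero_smul x)

noncomputable instance : LieRing (RelFree k A 𝔤 M) where
  bracket := Quot.map₂ .lie (fun x _ _ h => .lie_congr_right x h)
    (fun _ _ y h => .lie_congr_left y h)
  add_lie := by rintro ⟨x⟩ ⟨y⟩ ⟨z⟩; exact Quot.sound (.add_lie x y z)
  lie_add := by rintro ⟨x⟩ ⟨y⟩ ⟨z⟩; exact Quot.sound (.lie_add x y z)
  lie_self := by rintro ⟨x⟩; exact Quot.sound (.lie_self x)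
  leibniz_lie := by rintro ⟨x⟩ ⟨y⟩ ⟨z⟩; exact Quot.sound (.jacobi x y z)

theorem anchor_eq_of_rel {x y : LRTerm A M} (h : Rel k A 𝔤 M x y) :
    LRTerm.anchor k A 𝔤 M x = LRTerm.anchor k A 𝔤 M y := by
  induction h with
  | add_congr_left y _ ih => simp only [LRTerm.anchor, ih]
  | add_congr_right x _ ih => simp only [LRTerm.anchor, ih]
  | smul_congr f _ ih => simp only [LRTerm.anchor, ih]
  | lie_congr_left y _ ih => simp only [LRTerm.anchor, ih]
  | lie_congr_right x _ ih => simp only [LRTerm.anchor, ih]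
  | add_comm x y => exact _root_.add_comm _ _
  | add_assoc x y z => exact _root_.add_assoc _ _ _
  | zero_add x => exact _root_.zero_add _
  | smul_add f x y => exact _root_.smul_add _ _ _
  | add_smul f g x => exact _root_.add_smul _ _ _
  | mul_smul f g x => exact SemigroupAction.mul_smul _ _ _
  | one_smul x => exact _root_.one_smul _ _
  | zero_smul x => exact _root_.zero_smul _ _
  | add_lie x y z => exact _root_.add_lie _ _ _
  | lie_add x y z => exact _root_.lie_add _ _ _
  | lie_self x => exact _root_.lie_self _
  | jacobi x y z => exact leibniz_lie _ _ _
  | leibniz x f y =>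
    ext a
    simp only [LRTerm.anchor, Derivation.commutator_apply, Derivation.smul_apply,
      Derivation.add_apply, smul_eq_mul, Derivation.leibniz]
    ring
  | of_add m n => simp only [LRTerm.anchor, map_add]
  | of_smul f m => simp only [LRTerm.anchor, map_smul]
  | of_lie γ m =>
    simp only [LRTerm.anchor]
    rw [AnchoredModule.anchor_lie, AnchoredModule.anchor_incl]

/-- The action of `R(M, 𝔤)` on `A`. -/
noncomputable def anchorFun : RelFree k A 𝔤 M → Derivation k A A :=
  Quot.lift (LRTerm.anchor k A 𝔤 M) (fun _ _ h => anchor_eq_of_rel k A 𝔤 M h)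

noncomputable instance : LieRingModule (RelFree k A 𝔤 M) A where
  bracket x f := anchorFun k A 𝔤 M x f
  add_lie := by rintro ⟨x⟩ ⟨y⟩ f; rfl
  lie_add := by intro x f g; exact map_add _ f g
  leibniz_lie := by
    rintro ⟨x⟩ ⟨y⟩ f
    change LRTerm.anchor k A 𝔤 M x (LRTerm.anchor k A 𝔤 M y f) =
      ⁅LRTerm.anchor k A 𝔤 M x, LRTerm.anchor k A 𝔤 M y⁆ f +
        LRTerm.anchor k A 𝔤 M y (LRTerm.anchor k A 𝔤 M x f)
    rw [Derivation.commutator_apply, sub_add_cancel]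

instance : LieRinehartRing A (RelFree k A 𝔤 M) where
  lie_smul_eq_mul' := by rintro a b ⟨x⟩; rfl
  leibniz_mul_right' := by
    intro x a b
    change anchorFun k A 𝔤 M x (a * b) = a • anchorFun k A 𝔤 M x b + anchorFun k A 𝔤 M x a * b
    rw [Derivation.leibniz, smul_eq_mul, smul_eq_mul, mul_comm b]
  leibniz_smul_right' := by rintro ⟨x⟩ ⟨y⟩ a; exact Quot.sound (.leibniz x a y)

noncomputable instance : Module k (RelFree k A 𝔤 M) := Module.compHom _ (algebraMap k A)

instance : IsScalarTower k A (RelFree k A 𝔤 M) where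
  smul_assoc c f x := by
    change (c • f) • x = algebraMap k A c • f • x
    rw [Algebra.smul_def, SemigroupAction.mul_smul]

noncomputable instance : LieAlgebra k (RelFree k A 𝔤 M) where
  lie_smul c x y := by
    change ⁅x, algebraMap k A c • y⁆ = algebraMap k A c • ⁅x, y⁆
    rw [LieRinehartRing.leibniz_smul_right]
    change _ + anchorFun k A 𝔤 M x (algebraMap k A c) • y = _
    rw [Derivation.map_algebraMap, _root_.zero_smul, add_zero]

instance : LieRinehartAlgebra k A (RelFree k A 𝔤 M) where
  smul_lie c x f := by
    change ⁅algebraMap k A c • x, f⁆ = _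
    rw [LieRinehartRing.lie_smul_eq_mul, Algebra.smul_def]
  lie_smul c x f := by
    change anchorFun k A 𝔤 M x (c • f) = c • anchorFun k A 𝔤 M x f
    exact Derivation.map_smul _ c f

/-- The canonical `A`-linear map `M → R(M, 𝔤)`. -/
noncomputable def of : M →ₗ[A] RelFree k A 𝔤 M where
  toFun m := Quot.mk _ (.of m)
  map_add' m n := Quot.sound (.of_add m n)
  map_smul' f m := Quot.sound (.of_smul f m)

/-- The filtration of `R(M, 𝔤)`: `FiltLE d x` says that `x` lies in `R(M, 𝔤)_{≤ d}`, i.e. that it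
is a combination of iterated brackets of at most `d` generators. -/
inductive FiltLE : ℕ → RelFree k A 𝔤 M → Prop
  | of {d : ℕ} (m : M) : 1 ≤ d → FiltLE d (of k A 𝔤 M m)
  | zero {d : ℕ} : FiltLE d 0
  | add {d : ℕ} {x y : RelFree k A 𝔤 M} : FiltLE d x → FiltLE d y → FiltLE d (x + y)
  | smul {d : ℕ} (f : A) {x : RelFree k A 𝔤 M} : FiltLE d x → FiltLE d (f • x)
  | lie {i j d : ℕ} {x y : RelFree k A 𝔤 M} :
      FiltLE i x → FiltLE j y → i + j ≤ d → FiltLE d ⁅x, y⁆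

section UniversalProperty

variable {k A 𝔤 M}
variable {L : Type*} [LieRing L] [Module A L] [LieRingModule L A] [LieRinehartRing A L]
  [LieAlgebra k L] [LieRinehartAlgebra k A L]

/-- Auxiliary evaluation of formal expressions in a Lie–Rinehart algebra. -/
noncomputable def liftFun (φ : M →ₗ[A] L) : LRTerm A M → L
  | .of m => φ m
  | .zero => 0
  | .add x y => liftFun φ x + liftFun φ y
  | .smul f x => f • liftFun φ x
  | .lie x y => ⁅liftFun φ x, liftFun φ y⁆

theorem anchor_liftFun (φ : M →ₗ[A] L)
    (hanchor : ∀ m, LieRinehartAlgebra.anchor k A L (φ m) = AnchoredModule.anchor (k := k) 𝔤 m)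
    (x : LRTerm A M) :
    LieRinehartAlgebra.anchor k A L (liftFun φ x) = LRTerm.anchor k A 𝔤 M x := by
  induction x with
  | of m => exact hanchor m
  | zero => exact map_zero (LieRinehartAlgebra.anchor k A L).toLieHom
  | add x y hx hy =>
    simp only [LRTerm.anchor, ← hx, ← hy]
    exact map_add (LieRinehartAlgebra.anchor k A L).toLieHom _ _
  | smul f x hx =>
    simp only [LRTerm.anchor, ← hx]
    exact (LieRinehartAlgebra.anchor k A L).map_smul_apply' f _
  | lie x y hx hy =>
    simp only [LRTerm.anchor, ← hx, ← hy]
    exact LieHom.map_lie (LieRinehartAlgebra.anchor k A L).toLieHom _ _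

/-- Universal property of `R(M, 𝔤)`, existence: an `A`-linear map `φ` from `M` to a Lie–Rinehart
algebra `L` over `A` that respects the anchors and satisfies `[φ(ι(γ)), φ(m)] = φ(γ(m))` extends to
a morphism of Lie–Rinehart algebras. -/
noncomputable def lift (φ : M →ₗ[A] L)
    (hanchor : ∀ m, LieRinehartAlgebra.anchor k A L (φ m) = AnchoredModule.anchor (k := k) 𝔤 m)
    (hlie : ∀ (γ : 𝔤) (m : M), ⁅φ (AnchoredModule.incl k (A := A) (M := M) γ), φ m⁆ = φ ⁅γ, m⁆) :
    LieRinehartAlgebra.Hom (AlgHom.id k A) (RelFree k A 𝔤 M) L where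
  toFun := Quot.lift (liftFun φ) (by
    intro x y h
    induction h with
    | add_congr_left y _ ih => simp only [liftFun, ih]
    | add_congr_right x _ ih => simp only [liftFun, ih]
    | smul_congr f _ ih => simp only [liftFun, ih]
    | lie_congr_left y _ ih => simp only [liftFun, ih]
    | lie_congr_right x _ ih => simp only [liftFun, ih]
    | add_comm x y => exact _root_.add_comm _ _
    | add_assoc x y z => exact _root_.add_assoc _ _ _
    | zero_add x => exact _root_.zero_add _
    | smul_add f x y => exact _root_.smul_add _ _ _
    | add_smul f g x => exact _root_.add_smul _ _ _
    | mul_smul f g x => exact SemigroupAction.mul_smul _ _ _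
    | one_smul x => exact _root_.one_smul _ _
    | zero_smul x => exact _root_.zero_smul _ _
    | add_lie x y z => exact _root_.add_lie _ _ _
    | lie_add x y z => exact _root_.lie_add _ _ _
    | lie_self x => exact _root_.lie_self _
    | jacobi x y z => exact leibniz_lie _ _ _
    | leibniz x f y =>
      simp only [liftFun, ← anchor_liftFun φ hanchor, LieRinehartAlgebra.anchor_apply]
      exact LieRinehartRing.leibniz_smul_right _ _ _
    | of_add m n => exact map_add φ m n
    | of_smul f m => exact map_smul φ f m
    | of_lie γ m => exact hlie γ m)
  map_add' := by rintro ⟨x⟩ ⟨y⟩; rfl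
  map_smul' := by
    rintro c ⟨x⟩
    exact algebraMap_smul A c (liftFun φ x)
  map_lie' := by rintro ⟨x⟩ ⟨y⟩; rfl
  map_smul_apply' := by rintro a ⟨x⟩; rfl
  apply_lie' := by
    rintro a ⟨x⟩
    exact (DFunLike.congr_fun (anchor_liftFun φ hanchor x) a).symm

set_option linter.unusedSectionVars false in
/-- Universal property of `R(M, 𝔤)`, uniqueness. -/
theorem hom_ext (Φ Ψ : LieRinehartAlgebra.Hom (AlgHom.id k A) (RelFree k A 𝔤 M) L)
    (h : ∀ m, Φ.toLieHom (of k A 𝔤 M m) = Ψ.toLieHom (of k A 𝔤 M m)) (x : RelFree k A 𝔤 M) :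
    Φ.toLieHom x = Ψ.toLieHom x := by
  obtain ⟨x⟩ := x
  induction x with
  | of m => exact h m
  | zero => exact (map_zero Φ.toLieHom).trans (map_zero Ψ.toLieHom).symm
  | add x y hx hy =>
    let X : RelFree k A 𝔤 M := Quot.mk _ x
    let Y : RelFree k A 𝔤 M := Quot.mk _ y
    change Φ.toLieHom (X + Y) = Ψ.toLieHom (X + Y)
    rw [map_add, map_add, show Φ.toLieHom X = _ from hx, show Φ.toLieHom Y = _ from hy]
  | smul f x hx =>
    let X : RelFree k A 𝔤 M := Quot.mk _ x
    change Φ.toLieHom (f • X) = Ψ.toLieHom (f • X)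
    rw [Φ.map_smul_apply', Ψ.map_smul_apply', show Φ.toLieHom X = _ from hx]
  | lie x y hx hy =>
    let X : RelFree k A 𝔤 M := Quot.mk _ x
    let Y : RelFree k A 𝔤 M := Quot.mk _ y
    change Φ.toLieHom ⁅X, Y⁆ = Ψ.toLieHom ⁅X, Y⁆
    rw [LieHom.map_lie, LieHom.map_lie, show Φ.toLieHom X = _ from hx,
      show Φ.toLieHom Y = _ from hy]

end UniversalProperty

end RelFree

end RelFree

/-! ## Horizontal infinitesimal paths on a locally trivial bundle -/

section HorizontalPaths

variable {m n : ℕ}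
  {M : Type*} [TopologicalSpace M] [ChartedSpace (EuclideanSpace ℝ (Fin m)) M]
  {N : Type*} [TopologicalSpace N] [ChartedSpace (EuclideanSpace ℝ (Fin n)) N]

/-- Smooth vector fields on an `m`-dimensional manifold, as derivations of the algebra of smooth
functions. -/
abbrev SmoothVectorField (m : ℕ) (M : Type*) [TopologicalSpace M]
    [ChartedSpace (EuclideanSpace ℝ (Fin m)) M] : Type _ :=
  Derivation ℝ C^∞⟮𝓡 m, M; ℝ⟯ C^∞⟮𝓡 m, M; ℝ⟯

/-- The vector fields tangent to the fibres of `F : M → N`, i.e. those that annihilate all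
functions `h ∘ F`, `h` a smooth function on `N`. -/
def verticalFields (F : C^∞⟮𝓡 m, M; 𝓡 n, N⟯) :
    LieRinehartSubalgebra C^∞⟮𝓡 m, M; ℝ⟯ (SmoothVectorField m M) where
  carrier := {X | ∀ h : C^∞⟮𝓡 n, N; ℝ⟯, X (h.comp F) = 0}
  add_mem' := by
    intro X Y hX hY h
    rw [Derivation.add_apply, hX h, hY h, add_zero]
  zero_mem' := fun _ => rfl
  smul_mem' := by
    intro f X hX h
    rw [Derivation.smul_apply, hX h, smul_zero]
  lie_mem' := by
    intro X Y hX hY h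
    rw [Derivation.commutator_apply, hX h, hY h, map_zero, map_zero, sub_zero]

/-- All vector fields on `M`, as an anchored module over the vector fields tangent to the fibres
of `F`, acting by the Lie bracket. -/
noncomputable instance (F : C^∞⟮𝓡 m, M; 𝓡 n, N⟯) :
    AnchoredModule ℝ C^∞⟮𝓡 m, M; ℝ⟯ (verticalFields F) (SmoothVectorField m M) where
  incl := (verticalFields F).toSubmodule.subtype
  anchor := LinearMap.id
  incl_injective := Subtype.val_injective
  anchor_incl _ := rfl
  lie_smul γ f X := by
    refine Derivation.ext fun h => ?_
    change γ.1 (f * X h) - f * X (γ.1 h) = γ.1 f * X h + f * (γ.1 (X h) - X (γ.1 h))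
    rw [Derivation.leibniz, smul_eq_mul, smul_eq_mul]
    ring
  smul_lie f γ X := by
    refine Derivation.ext fun h => ?_
    change f * γ.1 (X h) - X (f * γ.1 h) = f * (γ.1 (X h) - X (γ.1 h)) - X f * γ.1 h
    rw [Derivation.leibniz, smul_eq_mul, smul_eq_mul]
    ring
  anchor_lie _ _ := rfl

/-- The relatively free Lie–Rinehart algebra `R(𝔛¹(M), 𝔛¹(F))` of `F`-horizontal infinitesimal
paths: the module of sections of the bundle `RT_N M`. -/
abbrev PathSections (F : C^∞⟮𝓡 m, M; 𝓡 n, N⟯) : Type _ :=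
  RelFree ℝ C^∞⟮𝓡 m, M; ℝ⟯ (verticalFields F) (SmoothVectorField m M)

/-- A vector field as an infinitesimal path. -/
noncomputable abbrev PathSections.ofField (F : C^∞⟮𝓡 m, M; 𝓡 n, N⟯) :
    SmoothVectorField m M →ₗ[C^∞⟮𝓡 m, M; ℝ⟯] PathSections F :=
  RelFree.of ℝ C^∞⟮𝓡 m, M; ℝ⟯ (verticalFields F) (SmoothVectorField m M)

/-- The ideal of smooth functions that vanish at `p`. -/
noncomputable def vanishingAt (m : ℕ) {M : Type*} [TopologicalSpace M]
    [ChartedSpace (EuclideanSpace ℝ (Fin m)) M] (p : M) : Ideal C^∞⟮𝓡 m, M; ℝ⟯ :=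
  RingHom.ker (ContMDiffMap.evalRingHom (I := 𝓡 m) (I' := 𝓘(ℝ, ℝ)) (n := ∞) (R := ℝ) p)

/-- The fibre at `p` of the bundle `RT_N M`, whose module of sections is `R(𝔛¹(M), 𝔛¹(F))`. -/
abbrev PathFibre (F : C^∞⟮𝓡 m, M; 𝓡 n, N⟯) (p : M) : Type _ :=
  PathSections F ⧸ (vanishingAt m p • (⊤ : Submodule C^∞⟮𝓡 m, M; ℝ⟯ (PathSections F)))

/-- The value of a section at a point. -/
noncomputable def PathSections.at {F : C^∞⟮𝓡 m, M; 𝓡 n, N⟯} (s : PathSections F) (p : M) :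
    PathFibre F p :=
  Submodule.Quotient.mk s

/-- The total space of the bundle `RT_N M` of `F`-horizontal infinitesimal paths. -/
structure PathBundle (F : C^∞⟮𝓡 m, M; 𝓡 n, N⟯) where
  base : M
  vec : PathFibre F base

/-- The subbundle `(RT_N M)_{≤ d}` of the filtration. -/
def PathBundle.filt (F : C^∞⟮𝓡 m, M; 𝓡 n, N⟯) (d : ℕ) : Set (PathBundle F) :=
  {v | ∃ s : PathSections F, RelFree.FiltLE _ _ _ _ d s ∧ v.vec = s.at v.base}

/-- A family of points of `RT_N M` parametrised by an open set `U` of a Euclidean space is smooth,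
if the base point depends smoothly on the parameter, and if locally the family is a finite
combination of sections with coefficients depending smoothly on the parameter. -/
def PathBundle.SmoothOn {F : C^∞⟮𝓡 m, M; 𝓡 n, N⟯} {k : ℕ}
    (c : EuclideanSpace ℝ (Fin k) → PathBundle F) (U : Set (EuclideanSpace ℝ (Fin k))) : Prop :=
  ContMDiffOn (𝓡 k) (𝓡 m) ∞ (fun u => (c u).base) U ∧
    ∀ u₀ ∈ U, ∃ V : Set (EuclideanSpace ℝ (Fin k)), IsOpen V ∧ u₀ ∈ V ∧ V ⊆ U ∧
      ∃ (r : ℕ) (g : Fin r → EuclideanSpace ℝ (Fin k) → ℝ) (s : Fin r → PathSections F),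
        (∀ i, ContDiffOn ℝ ∞ (g i) V) ∧
        ∀ u ∈ V, (c u).vec = ∑ i, g i u • (s i).at (c u).base

/-- The smooth structure of `RT_N M`, a union of vector bundles `(RT_N M)_{≤ d}` of finite rank. It
is given as a diffeology, i.e. through the smooth maps from Euclidean spaces to `RT_N M`: they are
the maps that locally are smooth sections of some `(RT_N M)_{≤ d}` along a smooth map to `M`. -/
noncomputable instance (F : C^∞⟮𝓡 m, M; 𝓡 n, N⟯) : DiffeologicalSpace (PathBundle F) :=
  .ofCorePlotsOn {
    isPlotOn := fun {_ u} _ c => PathBundle.SmoothOn c u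
    isPlotOn_congr := by
      intro k u hu c c' h
      have key : ∀ c c' : EuclideanSpace ℝ (Fin k) → PathBundle F, Set.EqOn c c' u →
          PathBundle.SmoothOn c u → PathBundle.SmoothOn c' u := by
        rintro c c' h ⟨h1, h2⟩
        refine ⟨h1.congr fun x hx => by rw [h hx], fun u₀ hu₀ => ?_⟩
        obtain ⟨V, hV, huV, hVu, r, g, s, hg, hs⟩ := h2 u₀ hu₀
        refine ⟨V, hV, huV, hVu, r, g, s, hg, fun x hx => ?_⟩
        have := hs x hx
        rwa [h (hVu hx)] at this
      exact ⟨key c c' h, key c' c h.symm⟩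
    isPlot_const := by
      rintro k ⟨p, v⟩
      obtain ⟨s, rfl⟩ := Submodule.Quotient.mk_surjective _ v
      refine ⟨contMDiffOn_const, fun u₀ _ => ⟨Set.univ, isOpen_univ, trivial, subset_rfl, 1,
        fun _ _ => 1, fun _ => s, fun _ => contDiffOn_const, fun u _ => ?_⟩⟩
      simp [PathSections.at]
    isPlotOn_reparam := by
      rintro k l u v hu hv c f h ⟨h1, h2⟩ hf
      refine ⟨h1.comp hf.contMDiffOn h, fun u₀ hu₀ => ?_⟩
      obtain ⟨V, hV, huV, hVu, r, g, s, hg, hs⟩ := h2 (f u₀) (h hu₀)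
      refine ⟨v ∩ f ⁻¹' V, hf.continuousOn.isOpen_inter_preimage hv hV, ⟨hu₀, huV⟩,
        Set.inter_subset_left, r, fun i => g i ∘ f, s, fun i => ?_, fun x hx => hs (f x) hx.2⟩
      exact (hg i).comp (hf.mono Set.inter_subset_left) (fun x hx => hx.2)
    locality := by
      intro k u hu c hc
      refine ⟨fun x hx => ?_, fun x hx => ?_⟩
      · obtain ⟨v, hv, hxv, h1, -⟩ := hc x hx
        exact ((h1 x hxv).contMDiffAt (hv.mem_nhds hxv)).contMDiffWithinAt
      · obtain ⟨v, hv, hxv, -, h2⟩ := hc x hx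
        obtain ⟨V, hV, hxV, hVv, r, g, s, hg, hs⟩ := h2 x hxv
        exact ⟨V ∩ u, hV.inter hu, ⟨hxV, hx⟩, Set.inter_subset_right, r, g, s,
          fun i => (hg i).mono Set.inter_subset_left, fun y hy => hs y hy.1⟩ }

end HorizontalPaths

/-! ## Locally trivial bundles and commutative squares -/

section Submersions

open OpenPartialHomeomorph

/-- A composite of submersions (of manifolds without boundary, modelled on vector spaces) is a
submersion. -/
theorem isSubmersion_comp {E₁ E₂ E₃ : Type} [NormedAddCommGroup E₁] [NormedSpace ℝ E₁]
    [NormedAddCommGroup E₂] [NormedSpace ℝ E₂] [NormedAddCommGroup E₃] [NormedSpace ℝ E₃]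
    {M₁ M₂ M₃ : Type*} [TopologicalSpace M₁] [ChartedSpace E₁ M₁] [IsManifold 𝓘(ℝ, E₁) ∞ M₁]
    [TopologicalSpace M₂] [ChartedSpace E₂ M₂] [IsManifold 𝓘(ℝ, E₂) ∞ M₂]
    [TopologicalSpace M₃] [ChartedSpace E₃ M₃] [IsManifold 𝓘(ℝ, E₃) ∞ M₃]
    {f : M₁ → M₂} {g : M₂ → M₃}
    (hg : Manifold.IsSubmersion 𝓘(ℝ, E₂) 𝓘(ℝ, E₃) ∞ g)
    (hf : Manifold.IsSubmersion 𝓘(ℝ, E₁) 𝓘(ℝ, E₂) ∞ f) :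
    Manifold.IsSubmersion 𝓘(ℝ, E₁) 𝓘(ℝ, E₃) ∞ (g ∘ f) := by
  have hgf : ContMDiff 𝓘(ℝ, E₁) 𝓘(ℝ, E₃) ∞ (g ∘ f) := hg.contMDiff.comp hf.contMDiff
  obtain ⟨F₁, _, _, hf⟩ := hf
  obtain ⟨F₂, _, _, hg⟩ := hg
  refine ⟨F₂ × F₁, inferInstance, inferInstance, fun x => ?_⟩
  have hfx := hf x
  have hgx := hg (f x)
  obtain ⟨φ, ψ, hφx, hψx, hφ, hψ, hsub, a, ha⟩ := hfx
  obtain ⟨ψ', χ, hψ'x, hχx, hψ', hχ, hsub', b, hb⟩ := hgx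
  let T : OpenPartialHomeomorph E₁ E₁ :=
    a.toHomeomorph.toOpenPartialHomeomorph ≫ₕ
      ((ψ.symm ≫ₕ ψ').prod (OpenPartialHomeomorph.refl F₁)) ≫ₕ
      a.symm.toHomeomorph.toOpenPartialHomeomorph
  have hψψ' : ψ.symm ≫ₕ ψ' ∈ contDiffGroupoid ∞ 𝓘(ℝ, E₂) :=
    StructureGroupoid.compatible_of_mem_maximalAtlas hψ hψ'
  rw [contDiffGroupoid, mem_groupoid_of_pregroupoid] at hψψ'
  have h1 : ContDiffOn ℝ ∞ (ψ.symm ≫ₕ ψ') (ψ.symm ≫ₕ ψ').source := by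
    simpa [contDiffPregroupoid] using hψψ'.1
  have h2 : ContDiffOn ℝ ∞ (ψ.symm ≫ₕ ψ').symm (ψ.symm ≫ₕ ψ').target := by
    simpa [contDiffPregroupoid] using hψψ'.2
  have hT : T ∈ contDiffGroupoid ∞ 𝓘(ℝ, E₁) := by
    rw [contDiffGroupoid, mem_groupoid_of_pregroupoid]
    have hT1 : ContDiffOn ℝ ∞ T T.source := by
      have : ContDiffOn ℝ ∞ (fun y => a.symm ((ψ.symm ≫ₕ ψ') (a y).1, (a y).2)) T.source := by
        refine a.symm.contDiff.comp_contDiffOn (ContDiffOn.prodMk ?_ ?_)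
        · refine h1.comp (contDiff_fst.comp a.contDiff).contDiffOn ?_
          intro y hy
          simpa [T] using hy
        · exact (contDiff_snd.comp a.contDiff).contDiffOn
      exact this
    have hT2 : ContDiffOn ℝ ∞ T.symm T.target := by
      have : ContDiffOn ℝ ∞ (fun y => a.symm ((ψ.symm ≫ₕ ψ').symm (a y).1, (a y).2)) T.target := by
        refine a.symm.contDiff.comp_contDiffOn (ContDiffOn.prodMk ?_ ?_)
        · refine h2.comp (contDiff_fst.comp a.contDiff).contDiffOn ?_
          intro y hy
          simpa [T] using hy
        · exact (contDiff_snd.comp a.contDiff).contDiffOn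
      exact this
    constructor
    · simpa [contDiffPregroupoid] using hT1
    · simpa [contDiffPregroupoid] using hT2
  have hTφ : φ ≫ₕ T ∈ IsManifold.maximalAtlas 𝓘(ℝ, E₁) ∞ M₁ := by
    refine mem_maximalAtlas_iff.mpr fun e he => ?_
    obtain ⟨h3, h4⟩ := mem_maximalAtlas_iff.mp hφ e he
    refine ⟨?_, ?_⟩
    · rw [trans_symm_eq_symm_trans_symm, trans_assoc]
      exact (contDiffGroupoid ∞ 𝓘(ℝ, E₁)).trans ((contDiffGroupoid ∞ 𝓘(ℝ, E₁)).symm hT) h3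
    · rw [← trans_assoc]
      exact (contDiffGroupoid ∞ 𝓘(ℝ, E₁)).trans h4 hT
  have key : ∀ z ∈ φ.source, ψ (f z) = (a (φ z)).1 := by
    intro z hz
    have := ha (x := φ z) (by simpa using φ.map_source hz)
    simpa [φ.left_inv hz] using this
  have key' : ∀ z ∈ ψ'.source, χ (g z) = (b (ψ' z)).1 := by
    intro z hz
    have := hb (x := ψ' z) (by simpa using ψ'.map_source hz)
    simpa [ψ'.left_inv hz] using this
  refine Manifold.IsSubmersionAtOfComplement.mk_of_continuousAt hgf.continuous.continuousAt
    ((a.trans (b.prodCongr (ContinuousLinearEquiv.refl ℝ F₁))).trans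
      (ContinuousLinearEquiv.prodAssoc ℝ E₃ F₂ F₁)) (φ ≫ₕ T) χ ?_ hχx hTφ hχ ?_
  · simp [T, hφx, ← key x hφx, hψ'x, hψx]
  · intro y hy
    obtain ⟨w, hw, rfl⟩ : ∃ w ∈ (φ ≫ₕ T).source, (φ ≫ₕ T) w = y := by
      have hy' : y ∈ (φ ≫ₕ T).target := by simpa using hy
      exact ⟨(φ ≫ₕ T).symm y, (φ ≫ₕ T).map_target hy', (φ ≫ₕ T).right_inv hy'⟩
    have hwφ : w ∈ φ.source := by
      rw [trans_source] at hw
      exact hw.1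
    have hwψ : f w ∈ ψ.source := hsub hwφ
    have hwψ' : f w ∈ ψ'.source := by
      have h5 : φ w ∈ T.source := by
        rw [trans_source] at hw
        exact hw.2
      simp only [T, trans_source, prod_source, refl_source] at h5
      have h6 := h5
      simp [← key w hwφ, ψ.left_inv hwψ] at h6
      exact h6.2
    have h7 : (φ ≫ₕ T).symm ((φ ≫ₕ T) w) = w := (φ ≫ₕ T).left_inv hw
    have h8 : a ((φ ≫ₕ T) w) = (ψ' (f w), (a (φ w)).2) := by
      simp [T, ← key w hwφ, ψ.left_inv hwψ]
    simp only [Function.comp_apply, extend_coe, extend_coe_symm, modelWithCornersSelf_coe,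
      modelWithCornersSelf_coe_symm, id_eq, h7, key' (f w) hwψ']
    change _ = (b (a ((φ ≫ₕ T) w)).1).1
    rw [h8]

theorem isSubmersion_id {E : Type} [NormedAddCommGroup E] [NormedSpace ℝ E]
    {M : Type*} [TopologicalSpace M] [ChartedSpace E M] [IsManifold 𝓘(ℝ, E) ∞ M] :
    Manifold.IsSubmersion 𝓘(ℝ, E) 𝓘(ℝ, E) ∞ (id : M → M) := by
  refine ⟨PUnit, inferInstance, inferInstance, fun x => ?_⟩
  refine Manifold.IsSubmersionAtOfComplement.mk_of_charts
    (ContinuousLinearEquiv.prodUnique ℝ E PUnit).symm (chartAt E x) (chartAt E x)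
    (mem_chart_source E x) (mem_chart_source E x) (IsManifold.chart_mem_maximalAtlas x)
    (IsManifold.chart_mem_maximalAtlas x) subset_rfl ?_
  intro y hy
  simpa using (chartAt E x).right_inv (by simpa using hy)

end Submersions

set_option linter.checkUnivs false in
/-- A locally trivial bundle `proj : total → base` of smooth manifolds (finite-dimensional,
Hausdorff, second countable): near each point of `total` there are charts of `total` and `base` in
which `proj` is a linear projection, i.e. locally on `total` it is a trivial bundle. -/
structure LocTrivBundle where
  dimTotal : ℕ
  dimBase : ℕ
  total : Type u
  base : Type v
  [topTotal : TopologicalSpace total]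
  [chartsTotal : ChartedSpace (EuclideanSpace ℝ (Fin dimTotal)) total]
  [manifoldTotal : IsManifold (𝓡 dimTotal) ∞ total]
  [t2Total : T2Space total]
  [countableTotal : SecondCountableTopology total]
  [topBase : TopologicalSpace base]
  [chartsBase : ChartedSpace (EuclideanSpace ℝ (Fin dimBase)) base]
  [manifoldBase : IsManifold (𝓡 dimBase) ∞ base]
  [t2Base : T2Space base]
  [countableBase : SecondCountableTopology base]
  proj : C^∞⟮𝓡 dimTotal, total; 𝓡 dimBase, base⟯
  locTriv : Manifold.IsSubmersion (𝓡 dimTotal) (𝓡 dimBase) ∞ proj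

attribute [instance] LocTrivBundle.topTotal LocTrivBundle.chartsTotal LocTrivBundle.manifoldTotal
  LocTrivBundle.t2Total LocTrivBundle.countableTotal LocTrivBundle.topBase LocTrivBundle.chartsBase
  LocTrivBundle.manifoldBase LocTrivBundle.t2Base LocTrivBundle.countableBase

/-- A commutative square between locally trivial bundles, whose horizontal maps are locally trivial
bundles as well. -/
structure BundleSquare (X Y : LocTrivBundle.{u, v}) where
  top : C^∞⟮𝓡 X.dimTotal, X.total; 𝓡 Y.dimTotal, Y.total⟯
  bot : C^∞⟮𝓡 X.dimBase, X.base; 𝓡 Y.dimBase, Y.base⟯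
  comm : Y.proj.comp top = bot.comp X.proj
  locTriv_top : Manifold.IsSubmersion (𝓡 X.dimTotal) (𝓡 Y.dimTotal) ∞ top
  locTriv_bot : Manifold.IsSubmersion (𝓡 X.dimBase) (𝓡 Y.dimBase) ∞ bot

/-- The identity square. -/
noncomputable def BundleSquare.id (X : LocTrivBundle.{u, v}) : BundleSquare X X where
  top := ContMDiffMap.id
  bot := ContMDiffMap.id
  comm := rfl
  locTriv_top := isSubmersion_id
  locTriv_bot := isSubmersion_id

/-- Horizontal composition of squares. -/
noncomputable def BundleSquare.comp {X Y Z : LocTrivBundle.{u, v}} (t : BundleSquare Y Z)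
    (s : BundleSquare X Y) : BundleSquare X Z where
  top := t.top.comp s.top
  bot := t.bot.comp s.bot
  comm := by
    ext x
    have h1 : Y.proj (s.top x) = s.bot (X.proj x) := congrArg (fun f => f x) s.comm
    have h2 : Z.proj (t.top (s.top x)) = t.bot (Y.proj (s.top x)) :=
      congrArg (fun f => f (s.top x)) t.comm
    exact h2.trans (congrArg t.bot h1)
  locTriv_top := isSubmersion_comp (f := s.top) (g := t.top) t.locTriv_top s.locTriv_top
  locTriv_bot := isSubmersion_comp (f := s.bot) (g := t.bot) t.locTriv_bot s.locTriv_bot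

/-- A fibrewise linear map `RT_{N₁} M₁ → RT_{N₂} M₂` over the top arrow `M₁ → M₂` of a square, given
by its linear maps on the fibres. -/
abbrev FibrewiseLinearMap {X Y : LocTrivBundle.{u, v}} (s : BundleSquare X Y) : Type _ :=
  ∀ p : X.total, PathFibre X.proj p →ₗ[ℝ] PathFibre Y.proj (s.top p)

/-- The map of total spaces given by a fibrewise linear map. -/
noncomputable def FibrewiseLinearMap.toFun {X Y : LocTrivBundle.{u, v}} {s : BundleSquare X Y}
    (L : FibrewiseLinearMap s) (v : PathBundle X.proj) : PathBundle Y.proj :=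
  ⟨s.top v.base, L v.base v.vec⟩

/-- The fibrewise linear map `L` is induced by the square `s`: it preserves the filtrations, it
extends the differential of the top arrow, and it takes iterated brackets of vector fields to the
iterated brackets of their images, whenever the vector fields are projectable near the point. The
condition `ξ (h ∘ φ) (p) = (η h) (φ p)` for all `h` says that the differential of `φ` takes the
value of `ξ` at `p` to the value of `η` at `φ p`; elements `w` of the free Lie algebra on `k`
letters are the linear combinations of formal iterated brackets. -/
structure FibrewiseLinearMap.IsInduced {X Y : LocTrivBundle.{u, v}} {s : BundleSquare X Y}
    (L : FibrewiseLinearMap s) : Prop where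
  map_filt : ∀ d : ℕ, Set.MapsTo L.toFun (PathBundle.filt X.proj d) (PathBundle.filt Y.proj d)
  map_field : ∀ (p : X.total) (ξ : SmoothVectorField X.dimTotal X.total)
    (η : SmoothVectorField Y.dimTotal Y.total),
    (∀ h : C^∞⟮𝓡 Y.dimTotal, Y.total; ℝ⟯, ξ (h.comp s.top) p = η h (s.top p)) →
      L p ((PathSections.ofField X.proj ξ).at p) = (PathSections.ofField Y.proj η).at (s.top p)
  map_bracket : ∀ (p : X.total) (k : ℕ) (ξ : Fin k → SmoothVectorField X.dimTotal X.total)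
    (η : Fin k → SmoothVectorField Y.dimTotal Y.total),
    (∀ i, ∀ᶠ q in 𝓝 p, ∀ h : C^∞⟮𝓡 Y.dimTotal, Y.total; ℝ⟯,
      ξ i (h.comp s.top) q = η i h (s.top q)) →
      ∀ w : FreeLieAlgebra ℝ (Fin k),
        L p ((FreeLieAlgebra.lift ℝ (fun i => PathSections.ofField X.proj (ξ i)) w).at p) =
          (FreeLieAlgebra.lift ℝ (fun i => PathSections.ofField Y.proj (η i)) w).at (s.top p)

/-!
A square with top arrow `φ` induces a map of bundles of infinitesimal paths because the relatively
free Lie–Rinehart algebra of the source maps to the pullback along `φ` of that of the target.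

Let `A` and `B` be the algebras of smooth functions on the source and the target of `φ`, let
`σ : B → A` be composition with `φ`, and let `R` be the Lie–Rinehart algebra over `B` of the target.
The pullback of `R` along `σ` consists of the pairs of a derivation `D` of `A` and an element `w` of
`A ⊗_B R` that induce the same derivation `B → A` (`Compatible`). Since `R` is not a Lie algebra
over `B`, the bracket is computed in the semidirect product `Der A ⋉ (A ⊗_ℝ R)` (`semiBracket`), and
the kernel of `A ⊗_ℝ R → A ⊗_B R` (`balancing`) turns out to be an ideal among the compatible pairs
(`semiBracket_sub_semiBracket_mem`). All of this is done modulo the ideal `I` of functions that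
vanish near a point `p`, which is stable under derivations.

A vector field `ξ` on the source is sent to the second component `∑ j, ξ (y j ∘ φ) ⊗ e j`, where the
`y j` are coordinates on the target near `φ p` and the `e j` are the coordinate fields. By the chain
rule this is compatible with `ξ`, and it is the only compatible element in the span of the vector
fields (`AdaptedFrame.sub_pushforward_mem`), hence independent of the coordinates. To extend the map
to iterated brackets, the relation `⟦γ, ξ⟧ = [γ, ξ]` for vertical `γ` has to be checked. If the
coordinates are adapted to the projection of the target, then each `e j` is vertical or `y j` is
pulled back from the base; in the second case `γ (y j ∘ φ) = 0` as the square commutes. Therefore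
the image of `γ` involves only vertical fields `e j`, the bracket of the images of `γ` and `ξ` is
again in the span of the vector fields by the same relation in `R`, and the uniqueness just
mentioned gives the claim (`AdaptedFrame.semiBracket_pushforward_mem`). That adapted coordinates
exist, and that derivations expand in them, is `exists_adapted_coordinates`; it rests on Hadamard's
lemma.

Evaluating `A ⊗_B R` at `p` gives the map of fibres (`BundleSquare.pathMap`). The statements about
filtrations, about related vector fields, and about smoothness follow by induction over iterated
brackets from the behaviour on vector fields. So does functoriality: an element of `R` that arises
as a vector of the pullback is transported a second time, and the formula for brackets in the
semidirect product is compatible with this substitution (`AdaptedFrame.exists_represents_comp`).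
-/

open scoped TensorProduct

/-! ### The semidirect product of derivations and a Lie algebra with extended scalars -/

section PullbackAlgebra

variable {k A B L : Type*} [CommRing k] [CommRing A] [Algebra k A] [CommRing B] [Algebra k B]
  [LieRing L] [LieAlgebra k L]

/-- The action of a derivation of `A` on the coefficients of `A ⊗ L`. -/
noncomputable def coeffAct (L : Type*) [LieRing L] [LieAlgebra k L] (D : Derivation k A A) :
    A ⊗[k] L →ₗ[k] A ⊗[k] L :=
  LinearMap.rTensor L (D : A →ₗ[k] A)

@[simp]
theorem coeffAct_tmul (D : Derivation k A A) (a : A) (s : L) :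
    coeffAct L D (a ⊗ₜ[k] s) = D a ⊗ₜ[k] s := rfl

theorem coeffAct_smul (D : Derivation k A A) (a : A) (w : A ⊗[k] L) :
    coeffAct L D (a • w) = a • coeffAct L D w + D a • w := by
  induction w with
  | zero => simp
  | tmul b s =>
    simp only [TensorProduct.smul_tmul', coeffAct_tmul, smul_eq_mul, Derivation.leibniz,
      TensorProduct.add_tmul, mul_comm b]
  | add x y hx hy => simp only [smul_add, map_add, hx, hy]; abel

theorem coeffAct_add_der (D D' : Derivation k A A) (w : A ⊗[k] L) :
    coeffAct L (D + D') w = coeffAct L D w + coeffAct L D' w := by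
  induction w with
  | zero => simp
  | tmul b s => simp [TensorProduct.add_tmul]
  | add x y hx hy => simp only [map_add, hx, hy]; abel

theorem coeffAct_smul_der (f : A) (D : Derivation k A A) (w : A ⊗[k] L) :
    coeffAct L (f • D) w = f • coeffAct L D w := by
  induction w with
  | zero => simp
  | tmul b s => simp [TensorProduct.smul_tmul']
  | add x y hx hy => simp only [map_add, hx, hy, smul_add]

theorem coeffAct_lie_der (D D' : Derivation k A A) (w : A ⊗[k] L) :
    coeffAct L ⁅D, D'⁆ w = coeffAct L D (coeffAct L D' w) - coeffAct L D' (coeffAct L D w) := by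
  induction w with
  | zero => simp
  | tmul b s => simp [Derivation.commutator_apply, TensorProduct.sub_tmul]
  | add x y hx hy => simp only [map_add, hx, hy]; abel

theorem coeffAct_lie (D : Derivation k A A) (w w' : A ⊗[k] L) :
    coeffAct L D ⁅w, w'⁆ = ⁅coeffAct L D w, w'⁆ + ⁅w, coeffAct L D w'⁆ := by
  induction w with
  | zero => simp
  | add x y hx hy => simp only [map_add, add_lie, hx, hy]; abel
  | tmul a s =>
    induction w' with
    | zero => simp
    | add x y hx hy => simp only [map_add, lie_add, hx, hy]; abel
    | tmul b t =>
      simp only [LieAlgebra.ExtendScalars.bracket_tmul, coeffAct_tmul, Derivation.leibniz,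
        smul_eq_mul, TensorProduct.add_tmul, mul_comm b]
      abel

theorem lie_sum_tmul {ι κ : Type*} [Fintype ι] [Fintype κ] (a : ι → A) (s : ι → L) (b : κ → A)
    (t : κ → L) : ⁅∑ i, a i ⊗ₜ[k] s i, ∑ j, b j ⊗ₜ[k] t j⁆ =
      ∑ i, ∑ j, (a i * b j) ⊗ₜ[k] ⁅s i, t j⁆ := by
  simp only [sum_lie_sum, LieAlgebra.ExtendScalars.bracket_tmul]

/-- The second component of the bracket of `(D, w)` and `(D', w')` in the semidirect product
`Der A ⋉ (A ⊗ L)`; the first component is `⁅D, D'⁆`. -/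
noncomputable def semiBracket (D : Derivation k A A) (w : A ⊗[k] L) (D' : Derivation k A A)
    (w' : A ⊗[k] L) : A ⊗[k] L :=
  ⁅w, w'⁆ + coeffAct L D w' - coeffAct L D' w

theorem semiBracket_jacobi (D₁ D₂ D₃ : Derivation k A A) (w₁ w₂ w₃ : A ⊗[k] L) :
    semiBracket D₁ w₁ ⁅D₂, D₃⁆ (semiBracket D₂ w₂ D₃ w₃) =
      semiBracket ⁅D₁, D₂⁆ (semiBracket D₁ w₁ D₂ w₂) D₃ w₃ +
        semiBracket D₂ w₂ ⁅D₁, D₃⁆ (semiBracket D₁ w₁ D₃ w₃) := by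
  simp only [semiBracket, lie_add, lie_sub, add_lie, sub_lie, map_add, map_sub, coeffAct_lie,
    coeffAct_lie_der, leibniz_lie w₁ w₂ w₃]
  rw [← lie_skew w₂ (coeffAct L D₃ w₁)]
  abel

theorem semiBracket_leibniz (D D' : Derivation k A A) (w w' : A ⊗[k] L) (f : A) :
    semiBracket D w (f • D') (f • w') = f • semiBracket D w D' w' + D f • w' := by
  simp only [semiBracket, lie_smul, coeffAct_smul, coeffAct_smul_der, smul_add, smul_sub]
  abel

/-! ### The pullback of a Lie–Rinehart algebra along a homomorphism -/

variable [Module B L] (σ : B →ₐ[k] A) (I : Ideal A)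

variable (k L) in
/-- The kernel of `A ⊗ L → (A / I) ⊗_B L`, as a submodule of the tensor product over the ground
ring. The bracket of `L` is not `B`-bilinear, so that brackets are computed in `A ⊗ L`, and only
their results are taken modulo this submodule. -/
def balancing : Submodule A (A ⊗[k] L) :=
  Submodule.span A ({w | ∃ (b : B) (s : L), w = σ b ⊗ₜ[k] s - 1 ⊗ₜ[k] (b • s)} ∪
    {w | ∃ i ∈ I, ∃ s : L, w = i ⊗ₜ[k] s})

variable {σ I}

theorem balance_mem (a : A) (b : B) (s : L) :
    (a * σ b) ⊗ₜ[k] s - a ⊗ₜ[k] (b • s) ∈ balancing k L σ I := by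
  have h := (balancing k L σ I).smul_mem a (Submodule.subset_span (Or.inl ⟨b, s, rfl⟩))
  simpa [smul_sub, TensorProduct.smul_tmul'] using h

theorem ideal_tmul_mem {a : A} (ha : a ∈ I) (s : L) : a ⊗ₜ[k] s ∈ balancing k L σ I :=
  Submodule.subset_span (Or.inr ⟨a, ha, s, rfl⟩)

variable [LieRingModule L B] [LieRinehartRing B L] [LieRinehartAlgebra k B L]

variable (σ) in
/-- The action on `b : B` of an element of `A ⊗ L`, with values in `A`: `a ⊗ s` sends `b` to
`a σ(s b)`. -/
noncomputable def pullAnchor (b : B) : A ⊗[k] L →ₗ[A] A :=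
  LinearMap.liftBaseChange A
    (σ.toLinearMap ∘ₗ (LieModule.toEnd k L B : L →ₗ[k] Module.End k B).flip b)

@[simp]
theorem pullAnchor_tmul (b : B) (a : A) (s : L) :
    pullAnchor σ b (a ⊗ₜ[k] s) = a * σ ⁅s, b⁆ := by
  simp [pullAnchor]

variable (σ I) in
/-- The derivation `D` of `A` and `w : A ⊗ L` induce, modulo `I`, the same derivation `B → A`
along `σ`. Modulo `I`, such pairs form the pullback of the Lie–Rinehart algebra `L` along `σ`. -/
def Compatible (D : Derivation k A A) (w : A ⊗[k] L) : Prop :=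
  ∀ b, D (σ b) - pullAnchor σ b w ∈ I

theorem pullAnchor_mem_of_mem_balancing {w : A ⊗[k] L} (hw : w ∈ balancing k L σ I) (b : B) :
    pullAnchor σ b w ∈ I := by
  induction hw using Submodule.span_induction with
  | mem x hx =>
    rcases hx with ⟨c, s, rfl⟩ | ⟨i, hi, s, rfl⟩
    · simp
    · simpa using I.mul_mem_right _ hi
  | zero => simp
  | add x y _ _ hx hy => simpa using add_mem hx hy
  | smul a x _ hx => simpa using I.mul_mem_left a hx

theorem Compatible.congr {D : Derivation k A A} {w w' : A ⊗[k] L} (h : Compatible σ I D w)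
    (hw : w - w' ∈ balancing k L σ I) : Compatible σ I D w' := by
  intro b
  have := add_mem (h b) (pullAnchor_mem_of_mem_balancing hw b)
  simpa using this

theorem Compatible.add {D D' : Derivation k A A} {w w' : A ⊗[k] L} (h : Compatible σ I D w)
    (h' : Compatible σ I D' w') : Compatible σ I (D + D') (w + w') := by
  intro b
  have := add_mem (h b) (h' b)
  simp only [Derivation.add_apply, map_add]
  convert this using 1
  ring

theorem Compatible.smul {D : Derivation k A A} {w : A ⊗[k] L} (f : A) (h : Compatible σ I D w) :
    Compatible σ I (f • D) (f • w) := by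
  intro b
  simpa [mul_sub] using I.mul_mem_left f (h b)

/-- The iterated action of two elements of `A ⊗ L` on `b : B`, where only the vectors of the second
one, not its coefficients, are differentiated. -/
noncomputable def pullAnchor₂ (b : B) (w : A ⊗[k] L) : A ⊗[k] L →ₗ[A] A :=
  LinearMap.liftBaseChange A
    { toFun := fun t => pullAnchor σ ⁅t, b⁆ w
      map_add' := fun s t => by
        induction w with
        | zero => simp
        | add x y hx hy => simp only [map_add, hx, hy]; abel
        | tmul a r => simp [mul_add]
      map_smul' := fun c t => by
        induction w with
        | zero => simp
        | add x y hx hy => simp only [map_add, hx, hy, smul_add]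
        | tmul a r => simp }

@[simp]
theorem pullAnchor₂_tmul (b : B) (w : A ⊗[k] L) (a : A) (t : L) :
    pullAnchor₂ (σ := σ) b w (a ⊗ₜ[k] t) = a * pullAnchor σ ⁅t, b⁆ w := by
  simp [pullAnchor₂]

theorem pullAnchor₂_add (b : B) (w₁ w₂ w : A ⊗[k] L) :
    pullAnchor₂ (σ := σ) b (w₁ + w₂) w =
      pullAnchor₂ (σ := σ) b w₁ w + pullAnchor₂ (σ := σ) b w₂ w := by
  induction w with
  | zero => simp
  | add x y hx hy => simp only [map_add, hx, hy]; abel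
  | tmul a t => simp [mul_add]

/-- The anchor of a bracket is the commutator of the iterated actions: the terms that contain
derivatives of the coefficients are absent on both sides. -/
theorem pullAnchor_lie (b : B) (w w' : A ⊗[k] L) :
    pullAnchor σ b ⁅w, w'⁆ =
      pullAnchor₂ (σ := σ) b w w' - pullAnchor₂ (σ := σ) b w' w := by
  induction w with
  | zero =>
    have : pullAnchor₂ (σ := σ) b (0 : A ⊗[k] L) w' = 0 := by
      simpa using pullAnchor₂_add (σ := σ) b 0 0 w'
    simp [this]
  | add x y hx hy => simp only [map_add, add_lie, hx, hy, pullAnchor₂_add]; abel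
  | tmul a s =>
    induction w' with
    | zero =>
      have : pullAnchor₂ (σ := σ) b (0 : A ⊗[k] L) (a ⊗ₜ s) = 0 := by
        simp
      simp [this]
    | add x y hx hy => simp only [map_add, lie_add, hx, hy, pullAnchor₂_add]; abel
    | tmul c t =>
      simp only [LieAlgebra.ExtendScalars.bracket_tmul, pullAnchor_tmul, pullAnchor₂_tmul,
        lie_lie, map_sub]
      ring

theorem Compatible.pullAnchor_coeffAct {D : Derivation k A A} {w : A ⊗[k] L}
    (h : Compatible σ I D w) (w' : A ⊗[k] L) (b : B) :
    D (pullAnchor σ b w') - pullAnchor σ b (coeffAct L D w') - pullAnchor₂ (σ := σ) b w w' ∈ I := by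
  induction w' with
  | zero => simp
  | add x y hx hy =>
    simp only [map_add]
    convert add_mem hx hy using 1
    ring
  | tmul a t =>
    simp only [pullAnchor_tmul, Derivation.leibniz, coeffAct_tmul, pullAnchor₂_tmul, smul_eq_mul]
    convert I.mul_mem_left a (h ⁅t, b⁆) using 1
    ring

/-- Compatible pairs form a Lie subalgebra of `Der A ⋉ (A ⊗ L)`. -/
theorem Compatible.semiBracket (hI : ∀ D : Derivation k A A, ∀ a ∈ I, D a ∈ I)
    {D D' : Derivation k A A} {w w' : A ⊗[k] L}
    (h : Compatible σ I D w) (h' : Compatible σ I D' w') :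
    Compatible σ I ⁅D, D'⁆ (semiBracket D w D' w') := by
  intro b
  have h1 := sub_mem (hI D _ (h' b)) (hI D' _ (h b))
  have h2 := sub_mem (h.pullAnchor_coeffAct w' b) (h'.pullAnchor_coeffAct w b)
  simp only [_root_.semiBracket, map_add, map_sub, pullAnchor_lie,
    Derivation.commutator_apply] at h1 h2 ⊢
  convert add_mem h1 h2 using 1
  ring

/-- The bracket of a compatible pair `(D, w)` with `(0, κ)`, where `κ` lies in the balancing
submodule, lies in this submodule again. Compatibility is essential: on the generator
`σ b ⊗ s - 1 ⊗ b s`, the Leibniz rule of `L` produces the term `w(b) ⊗ s`, and the action of `D` on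
coefficients produces `D (σ b) ⊗ s`. -/
theorem lie_sub_coeffAct_mem (hI : ∀ D : Derivation k A A, ∀ a ∈ I, D a ∈ I)
    {D : Derivation k A A} {w κ : A ⊗[k] L} (h : Compatible σ I D w)
    (hκ : κ ∈ balancing k L σ I) :
    ⁅κ, w⁆ - coeffAct L D κ ∈ balancing k L σ I := by
  induction hκ using Submodule.span_induction with
  | mem x hx =>
    rcases hx with ⟨b, s, rfl⟩ | ⟨i, hi, s, rfl⟩
    · have h1 : ∀ w : A ⊗[k] L, ⁅σ b ⊗ₜ[k] s - 1 ⊗ₜ[k] (b • s), w⁆ - pullAnchor σ b w ⊗ₜ[k] s ∈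
          balancing k L σ I := by
        intro w
        induction w with
        | zero => simp
        | add x y hx hy =>
          simp only [map_add, lie_add, TensorProduct.add_tmul]
          convert add_mem hx hy using 1
          abel
        | tmul a t =>
          have e : ⁅b • s, t⁆ = b • ⁅s, t⁆ - ⁅t, b⁆ • s := by
            rw [← lie_skew, LieRinehartRing.leibniz_smul_right, ← lie_skew t s, smul_neg, neg_add,
              neg_neg, sub_eq_add_neg]
          convert sub_mem (balance_mem (σ := σ) (I := I) a b ⁅s, t⁆)
            (balance_mem a ⁅t, b⁆ s) using 1
          simp only [sub_lie, LieAlgebra.ExtendScalars.bracket_tmul, e, TensorProduct.tmul_sub,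
            pullAnchor_tmul, one_mul, mul_comm (σ b)]
          abel
      convert sub_mem (h1 w) (ideal_tmul_mem (h b) s) using 1
      simp only [map_sub, coeffAct_tmul, Derivation.map_one_eq_zero, TensorProduct.zero_tmul,
        TensorProduct.sub_tmul]
      abel
    · refine sub_mem ?_ (ideal_tmul_mem (hI D i hi) s)
      clear h
      induction w with
      | zero => simp
      | add x y hx hy => simpa using add_mem hx hy
      | tmul a t => exact ideal_tmul_mem (I.mul_mem_right a hi) _
  | zero => simp
  | add x y _ _ hx hy =>
    simp only [map_add, add_lie]
    convert add_mem hx hy using 1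
    abel
  | smul a x hx' hx =>
    convert sub_mem ((balancing k L σ I).smul_mem a hx)
      ((balancing k L σ I).smul_mem (D a) hx') using 1
    simp only [smul_lie, coeffAct_smul, smul_sub]
    abel

/-- The balancing submodule is an ideal among the compatible pairs: the bracket of compatible pairs
depends on their second components only modulo the balancing submodule. -/
theorem semiBracket_sub_semiBracket_mem (hI : ∀ D : Derivation k A A, ∀ a ∈ I, D a ∈ I)
    {D D' : Derivation k A A} {w₁ w₂ w₁' w₂' : A ⊗[k] L}
    (h : Compatible σ I D w₁) (h' : Compatible σ I D' w₁')
    (hw : w₁ - w₂ ∈ balancing k L σ I) (hw' : w₁' - w₂' ∈ balancing k L σ I) :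
    semiBracket D w₁ D' w₁' - semiBracket D w₂ D' w₂' ∈ balancing k L σ I := by
  have h2 := h.congr hw
  convert sub_mem (lie_sub_coeffAct_mem hI h' hw) (lie_sub_coeffAct_mem hI h2 hw') using 1
  simp only [semiBracket, map_sub, sub_lie]
  rw [← lie_skew w₁' w₂, ← lie_skew w₂' w₂]
  abel

end PullbackAlgebra

/-! ### Maps from a relatively free Lie–Rinehart algebra to a pullback -/

section Transport

namespace RelFree

section Lift

variable {k A B 𝔤 M L : Type*} [CommRing k] [CommRing A] [Algebra k A] [CommRing B] [Algebra k B]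
  [LieRing 𝔤] [Module A 𝔤] [LieRingModule 𝔤 A] [LieRinehartRing A 𝔤]
  [LieAlgebra k 𝔤] [LieRinehartAlgebra k A 𝔤]
  [AddCommGroup M] [Module A M] [LieRingModule 𝔤 M] [AnchoredModule k A 𝔤 M]
  [LieRing L] [Module B L] [LieRingModule L B] [LieRinehartRing B L]
  [LieAlgebra k L] [LieRinehartAlgebra k B L]

/-- Evaluation of formal expressions in `A ⊗ L`, where brackets are evaluated as in
`Der A ⋉ (A ⊗ L)`. -/
noncomputable def pullbackEval (𝔤 : Type*) [LieRing 𝔤] [Module A 𝔤] [LieRingModule 𝔤 A]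
    [LieRinehartRing A 𝔤] [LieAlgebra k 𝔤] [LieRinehartAlgebra k A 𝔤] [LieRingModule 𝔤 M]
    [AnchoredModule k A 𝔤 M] (δ : M →ₗ[A] A ⊗[k] L) : LRTerm A M → A ⊗[k] L
  | .of m => δ m
  | .zero => 0
  | .add x y => pullbackEval 𝔤 δ x + pullbackEval 𝔤 δ y
  | .smul f x => f • pullbackEval 𝔤 δ x
  | .lie x y => semiBracket (LRTerm.anchor k A 𝔤 M x) (pullbackEval 𝔤 δ x)
      (LRTerm.anchor k A 𝔤 M y) (pullbackEval 𝔤 δ y)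

variable {σ : B →ₐ[k] A} {I : Ideal A} {δ : M →ₗ[A] A ⊗[k] L}

theorem compatible_pullbackEval (hI : ∀ D : Derivation k A A, ∀ a ∈ I, D a ∈ I)
    (hδ : ∀ m : M, Compatible σ I (AnchoredModule.anchor 𝔤 m) (δ m)) (x : LRTerm A M) :
    Compatible σ I (LRTerm.anchor k A 𝔤 M x) (pullbackEval 𝔤 δ x) := by
  induction x with
  | of m => exact hδ m
  | zero => intro b; simp [pullbackEval, LRTerm.anchor]
  | add x y hx hy => exact hx.add hy
  | smul f x hx => exact hx.smul f
  | lie x y hx hy => exact hx.semiBracket hI hy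

/-- Evaluation respects the relations of `R(M, 𝔤)`. Only `of_lie` needs a hypothesis on `δ`; all the
others are identities in `Der A ⋉ (A ⊗ L)`. -/
theorem pullbackEval_sub_mem (hI : ∀ D : Derivation k A A, ∀ a ∈ I, D a ∈ I)
    (hδ : ∀ m : M, Compatible σ I (AnchoredModule.anchor 𝔤 m) (δ m))
    (hlie : ∀ (γ : 𝔤) (m : M),
      semiBracket (AnchoredModule.anchor 𝔤 (AnchoredModule.incl k (A := A) (M := M) γ))
        (δ (AnchoredModule.incl k (A := A) (M := M) γ)) (AnchoredModule.anchor 𝔤 m) (δ m) -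
        δ ⁅γ, m⁆ ∈ balancing k L σ I)
    {x y : LRTerm A M} (h : Rel k A 𝔤 M x y) :
    pullbackEval 𝔤 δ x - pullbackEval 𝔤 δ y ∈ balancing k L σ I := by
  have of_eq : ∀ {w w' : A ⊗[k] L}, w = w' → w - w' ∈ balancing k L σ I := by
    rintro w _ rfl
    simp
  have hc := compatible_pullbackEval (𝔤 := 𝔤) hI hδ
  induction h with
  | add_congr_left y _ ih => simpa [pullbackEval] using ih
  | add_congr_right x _ ih => simpa [pullbackEval] using ih
  | smul_congr f _ ih => simpa [pullbackEval, smul_sub] using (balancing k L σ I).smul_mem f ih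
  | lie_congr_left y h ih =>
    simp only [pullbackEval, ← anchor_eq_of_rel k A 𝔤 M h]
    exact semiBracket_sub_semiBracket_mem hI (hc _) (hc _) ih (by simp)
  | lie_congr_right x h ih =>
    simp only [pullbackEval, ← anchor_eq_of_rel k A 𝔤 M h]
    exact semiBracket_sub_semiBracket_mem hI (hc _) (hc _) (by simp) ih
  | add_comm x y => exact of_eq (_root_.add_comm _ _)
  | add_assoc x y z => exact of_eq (_root_.add_assoc _ _ _)
  | zero_add x => exact of_eq (_root_.zero_add _)
  | smul_add f x y => exact of_eq (_root_.smul_add _ _ _)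
  | add_smul f g x => exact of_eq (_root_.add_smul _ _ _)
  | mul_smul f g x => exact of_eq (SemigroupAction.mul_smul _ _ _)
  | one_smul x => exact of_eq (_root_.one_smul _ _)
  | zero_smul x => exact of_eq (_root_.zero_smul _ _)
  | add_lie x y z =>
    refine of_eq ?_
    simp only [pullbackEval, LRTerm.anchor, semiBracket, _root_.add_lie, coeffAct_add_der, map_add]
    abel
  | lie_add x y z =>
    refine of_eq ?_
    simp only [pullbackEval, LRTerm.anchor, semiBracket, _root_.lie_add, coeffAct_add_der, map_add]
    abel
  | lie_self x => exact of_eq (by simp [pullbackEval, semiBracket])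
  | jacobi x y z => exact of_eq (semiBracket_jacobi _ _ _ _ _ _)
  | leibniz x f y => exact of_eq (semiBracket_leibniz _ _ _ _ _)
  | of_add m n => exact of_eq (map_add δ m n)
  | of_smul f m => exact of_eq (map_smul δ f m)
  | of_lie γ m => exact hlie γ m

end Lift

end RelFree

variable {k A B 𝔤 M 𝔥 N : Type*} [CommRing k] [CommRing A] [Algebra k A]
  [CommRing B] [Algebra k B]
  [LieRing 𝔤] [Module A 𝔤] [LieRingModule 𝔤 A] [LieRinehartRing A 𝔤]
  [LieAlgebra k 𝔤] [LieRinehartAlgebra k A 𝔤]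
  [AddCommGroup M] [Module A M] [LieRingModule 𝔤 M] [AnchoredModule k A 𝔤 M]
  [LieRing 𝔥] [Module B 𝔥] [LieRingModule 𝔥 B] [LieRinehartRing B 𝔥]
  [LieAlgebra k 𝔥] [LieRinehartAlgebra k B 𝔥]
  [AddCommGroup N] [Module B N] [LieRingModule 𝔥 N] [AnchoredModule k B 𝔥 N]

namespace RelFree

theorem of_lie_eq (η : N) (b : B) : ⁅of k B 𝔥 N η, b⁆ = AnchoredModule.anchor (k := k) 𝔥 η b := rfl

theorem incl_lie_of (h : 𝔥) (η : N) :
    ⁅of k B 𝔥 N (AnchoredModule.incl k (A := B) (M := N) h), of k B 𝔥 N η⁆ = of k B 𝔥 N ⁅h, η⁆ :=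
  Quot.sound (.of_lie h η)

end RelFree

variable (k A 𝔥 N) in
/-- The `A`-submodule of `A ⊗ R(N, 𝔥)` generated by `N`. -/
noncomputable def generatorSpan : Submodule A (A ⊗[k] RelFree k B 𝔥 N) :=
  Submodule.span A (Set.range fun η : N => 1 ⊗ₜ[k] RelFree.of k B 𝔥 N η)

theorem tmul_of_mem_generatorSpan (a : A) (η : N) :
    a ⊗ₜ[k] RelFree.of k B 𝔥 N η ∈ generatorSpan k A 𝔥 N (B := B) := by
  have h := (generatorSpan k A 𝔥 N (B := B)).smul_mem a (Submodule.subset_span ⟨η, rfl⟩)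
  simpa [TensorProduct.smul_tmul'] using h

theorem coeffAct_mem_generatorSpan (D : Derivation k A A) {w : A ⊗[k] RelFree k B 𝔥 N}
    (hw : w ∈ generatorSpan k A 𝔥 N (B := B)) :
    coeffAct _ D w ∈ generatorSpan k A 𝔥 N (B := B) := by
  induction hw using Submodule.span_induction with
  | mem x hx =>
    obtain ⟨η, rfl⟩ := hx
    simp
  | zero => simp
  | add x y _ _ hx hy => simpa using add_mem hx hy
  | smul a x hx' hx =>
    rw [coeffAct_smul]
    exact add_mem (Submodule.smul_mem _ _ hx) (Submodule.smul_mem _ _ hx')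

variable (k 𝔤 M 𝔥 N) in
/-- A finite frame of the anchored `(𝔥, B)`-module `N`, together with coordinates, modulo the ideal
`I` of `A`, where `A` is a `B`-algebra through `σ`; it is adapted in the sense that each vector of
the frame comes from `𝔥`, or else its coordinate is annihilated by `𝔤`. For germs of vector fields
this is the frame given by coordinates adapted to a submersion, and `chain` is the chain rule. The
function `χ` in `expand` is a cutoff function: the expansion in the frame is available only
locally. -/
structure AdaptedFrame (σ : B →ₐ[k] A) (I : Ideal A) where
  ι : Type
  [fintype : Fintype ι]
  coord : ι → B
  field : ι → N
  expand : ∀ η : N, ∃ χ : B, 1 - σ χ ∈ I ∧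
    χ • η = χ • ∑ j, AnchoredModule.anchor (k := k) 𝔥 η (coord j) • field j
  chain : ∀ (m : M) (b : B), AnchoredModule.anchor (k := k) 𝔤 m (σ b) -
    ∑ j, AnchoredModule.anchor (k := k) 𝔤 m (σ (coord j)) *
      σ (AnchoredModule.anchor (k := k) 𝔥 (field j) b) ∈ I
  adapted : ∀ j, (∃ h : 𝔥, field j = AnchoredModule.incl k (A := B) h) ∨
    ∀ γ : 𝔤, AnchoredModule.anchor (k := k) 𝔤 (AnchoredModule.incl k (A := A) (M := M) γ)
      (σ (coord j)) = 0

attribute [instance] AdaptedFrame.fintype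

namespace AdaptedFrame

variable {σ : B →ₐ[k] A} {I : Ideal A} (fr : AdaptedFrame k 𝔤 M 𝔥 N σ I)

/-- The expansion of elements of `N` in the frame, modulo the balancing submodule. -/
theorem tmul_of_sub_mem (a : A) (η : N) :
    a ⊗ₜ[k] RelFree.of k B 𝔥 N η -
      ∑ j, (a * σ (AnchoredModule.anchor (k := k) 𝔥 η (fr.coord j))) ⊗ₜ[k]
        RelFree.of k B 𝔥 N (fr.field j) ∈ balancing k (RelFree k B 𝔥 N) σ I := by
  obtain ⟨χ, hχ, h⟩ := fr.expand η
  set S := ∑ j, AnchoredModule.anchor (k := k) 𝔥 η (fr.coord j) • fr.field j with hS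
  have cut : ∀ ζ : N, a ⊗ₜ[k] RelFree.of k B 𝔥 N ζ - a ⊗ₜ[k] RelFree.of k B 𝔥 N (χ • ζ) ∈
      balancing k (RelFree k B 𝔥 N) σ I := by
    intro ζ
    have h1 := ideal_tmul_mem (k := k) (σ := σ) (I.mul_mem_left a hχ) (RelFree.of k B 𝔥 N ζ)
    have h2 := balance_mem (k := k) (σ := σ) (I := I) a χ (RelFree.of k B 𝔥 N ζ)
    convert add_mem h1 h2 using 1
    simp only [mul_sub, mul_one, TensorProduct.sub_tmul, map_smul]
    abel
  have h1 := sub_mem (cut η) (cut S)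
  rw [h] at h1
  have h2 : a ⊗ₜ[k] RelFree.of k B 𝔥 N S -
      ∑ j, (a * σ (AnchoredModule.anchor (k := k) 𝔥 η (fr.coord j))) ⊗ₜ[k]
        RelFree.of k B 𝔥 N (fr.field j) ∈ balancing k (RelFree k B 𝔥 N) σ I := by
    rw [hS, map_sum, TensorProduct.tmul_sum, ← Finset.sum_sub_distrib]
    refine Submodule.sum_mem _ fun j _ => ?_
    rw [← neg_mem_iff, neg_sub, map_smul]
    exact balance_mem _ _ _
  convert add_mem h1 h2 using 1
  abel

/-- An element of `A ⊗ R(N, 𝔥)` in the span of `N` is determined by its action on `B`, modulo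
`balancing`. -/
theorem sub_sum_mem {w : A ⊗[k] RelFree k B 𝔥 N} (hw : w ∈ generatorSpan k A 𝔥 N (B := B)) :
    w - ∑ j, (pullAnchor σ (fr.coord j) w) ⊗ₜ[k] RelFree.of k B 𝔥 N (fr.field j) ∈
      balancing k (RelFree k B 𝔥 N) σ I := by
  induction hw using Submodule.span_induction with
  | mem x hx =>
    obtain ⟨η, rfl⟩ := hx
    simpa [RelFree.of_lie_eq] using fr.tmul_of_sub_mem 1 η
  | zero => simp
  | add x y _ _ hx hy =>
    convert add_mem hx hy using 1
    simp only [map_add, TensorProduct.add_tmul, Finset.sum_add_distrib]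
    abel
  | smul a x _ hx =>
    convert Submodule.smul_mem _ a hx using 1
    simp only [map_smul, smul_sub, Finset.smul_sum, TensorProduct.smul_tmul']

/-- The expression of the pushforward of `m` along `σ` in the frame. -/
noncomputable def pushforward : M →ₗ[A] A ⊗[k] RelFree k B 𝔥 N where
  toFun m := ∑ j, (AnchoredModule.anchor (k := k) 𝔤 m (σ (fr.coord j))) ⊗ₜ[k]
    RelFree.of k B 𝔥 N (fr.field j)
  map_add' m n := by simp [TensorProduct.add_tmul, Finset.sum_add_distrib]
  map_smul' f m := by simp [Finset.smul_sum, TensorProduct.smul_tmul']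

theorem pushforward_mem (m : M) : fr.pushforward m ∈ generatorSpan k A 𝔥 N (B := B) :=
  Submodule.sum_mem _ fun _ _ => tmul_of_mem_generatorSpan _ _

theorem sub_pushforward_mem {w : A ⊗[k] RelFree k B 𝔥 N}
    (hw : w ∈ generatorSpan k A 𝔥 N (B := B)) {m : M}
    (hm : Compatible σ I (AnchoredModule.anchor 𝔤 m) w) :
    w - fr.pushforward m ∈ balancing k (RelFree k B 𝔥 N) σ I := by
  rw [← sub_add_sub_cancel w
    (∑ j, (pullAnchor σ (fr.coord j) w) ⊗ₜ[k] RelFree.of k B 𝔥 N (fr.field j))]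
  refine add_mem (fr.sub_sum_mem hw) ?_
  rw [← neg_mem_iff, neg_sub]
  change (∑ j, _) - _ ∈ _
  rw [← Finset.sum_sub_distrib]
  refine Submodule.sum_mem _ fun j _ => ?_
  rw [← TensorProduct.sub_tmul]
  exact ideal_tmul_mem (hm _) _

/-- The step that uses the relation `[ι(γ), m] = γ(m)` of the target: the pushforward of an element
of `𝔤` involves only those vectors of the frame that come from `𝔥`, and their brackets with elements
of `N` lie in `N` again. -/
theorem pushforward_incl_lie_mem (γ : 𝔤) (m : M) :
    ⁅fr.pushforward (AnchoredModule.incl k (A := A) (M := M) γ), fr.pushforward m⁆ ∈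
      generatorSpan k A 𝔥 N (B := B) := by
  simp only [pushforward, LinearMap.coe_mk, AddHom.coe_mk, lie_sum_tmul]
  refine Submodule.sum_mem _ fun i _ => Submodule.sum_mem _ fun j _ => ?_
  rcases fr.adapted i with ⟨h, hh⟩ | h0
  · rw [hh, RelFree.incl_lie_of]
    exact tmul_of_mem_generatorSpan _ _
  · rw [h0]
    simp

theorem compatible_pushforward (m : M) :
    Compatible σ I (AnchoredModule.anchor 𝔤 m) (fr.pushforward m) := by
  intro b
  simpa [pushforward, RelFree.of_lie_eq] using fr.chain m b

/-- The relation `[ι(γ), m] = γ(m)` holds for the pushforwards: both sides lie in the span of `N`,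
where elements are determined by their action on `B`. -/
theorem semiBracket_pushforward_mem (hI : ∀ D : Derivation k A A, ∀ a ∈ I, D a ∈ I)
    (γ : 𝔤) (m : M) :
    semiBracket (AnchoredModule.anchor 𝔤 (AnchoredModule.incl k (A := A) (M := M) γ))
      (fr.pushforward (AnchoredModule.incl k (A := A) (M := M) γ)) (AnchoredModule.anchor 𝔤 m)
      (fr.pushforward m) - fr.pushforward ⁅γ, m⁆ ∈ balancing k (RelFree k B 𝔥 N) σ I := by
  refine fr.sub_pushforward_mem ?_ ?_
  · exact sub_mem (add_mem (fr.pushforward_incl_lie_mem γ m)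
      (coeffAct_mem_generatorSpan _ (fr.pushforward_mem m)))
      (coeffAct_mem_generatorSpan _ (fr.pushforward_mem _))
  · rw [AnchoredModule.anchor_lie, ← AnchoredModule.anchor_incl (M := M)]
    exact (fr.compatible_pushforward _).semiBracket hI (fr.compatible_pushforward _)

/-- The map `R(M, 𝔤) → (A / I) ⊗_B R(N, 𝔥)` that extends the pushforward of the elements of `M`
along `σ`. -/
noncomputable def transport (hI : ∀ D : Derivation k A A, ∀ a ∈ I, D a ∈ I) :
    RelFree k A 𝔤 M →ₗ[A] (A ⊗[k] RelFree k B 𝔥 N) ⧸ balancing k (RelFree k B 𝔥 N) σ I where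
  toFun := Quot.lift (fun x => Submodule.Quotient.mk (RelFree.pullbackEval 𝔤 fr.pushforward x))
    fun _ _ h => (Submodule.Quotient.eq _).mpr
      (RelFree.pullbackEval_sub_mem hI fr.compatible_pushforward
        (fr.semiBracket_pushforward_mem hI) h)
  map_add' := by rintro ⟨x⟩ ⟨y⟩; rfl
  map_smul' := by rintro f ⟨x⟩; rfl

variable (hI : ∀ D : Derivation k A A, ∀ a ∈ I, D a ∈ I)

/-- The element `w` of `A ⊗ R(N, 𝔥)` represents the image of `x` under `transport`. -/
def Represents (x : RelFree k A 𝔤 M) (w : A ⊗[k] RelFree k B 𝔥 N) : Prop :=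
  fr.transport hI x = Submodule.Quotient.mk w

variable {fr hI}

namespace Represents

theorem compatible {x : RelFree k A 𝔤 M} {w : A ⊗[k] RelFree k B 𝔥 N}
    (h : fr.Represents hI x w) : Compatible σ I (RelFree.anchorFun k A 𝔤 M x) w := by
  obtain ⟨x⟩ := x
  exact (RelFree.compatible_pullbackEval hI fr.compatible_pushforward x).congr
    ((Submodule.Quotient.eq _).mp h)

theorem congr {x : RelFree k A 𝔤 M} {w w' : A ⊗[k] RelFree k B 𝔥 N}
    (h : fr.Represents hI x w) (hw : w - w' ∈ balancing k (RelFree k B 𝔥 N) σ I) :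
    fr.Represents hI x w' :=
  Eq.trans h ((Submodule.Quotient.eq _).mpr hw)

/-- Any `w` in the span of `N` that acts on `B` as `m` does represents the image of `m`. In
particular, the image of an element of `M` does not depend on the frame. -/
theorem of {m : M} {w : A ⊗[k] RelFree k B 𝔥 N} (hw : w ∈ generatorSpan k A 𝔥 N (B := B))
    (hm : Compatible σ I (AnchoredModule.anchor 𝔤 m) w) :
    fr.Represents hI (RelFree.of k A 𝔤 M m) w :=
  ((Submodule.Quotient.eq _).mpr (fr.sub_pushforward_mem hw hm)).symm

theorem zero : fr.Represents hI 0 0 := map_zero (fr.transport hI)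

theorem add {x y : RelFree k A 𝔤 M} {w w' : A ⊗[k] RelFree k B 𝔥 N}
    (h : fr.Represents hI x w) (h' : fr.Represents hI y w') :
    fr.Represents hI (x + y) (w + w') := by
  rw [Represents, map_add, h, h', Submodule.Quotient.mk_add]

theorem smul {x : RelFree k A 𝔤 M} {w : A ⊗[k] RelFree k B 𝔥 N} (f : A)
    (h : fr.Represents hI x w) : fr.Represents hI (f • x) (f • w) := by
  rw [Represents, map_smul, h, Submodule.Quotient.mk_smul]

theorem lie {x y : RelFree k A 𝔤 M} {w w' : A ⊗[k] RelFree k B 𝔥 N}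
    (h : fr.Represents hI x w) (h' : fr.Represents hI y w') :
    fr.Represents hI ⁅x, y⁆
      (semiBracket (RelFree.anchorFun k A 𝔤 M x) w (RelFree.anchorFun k A 𝔤 M y) w') := by
  obtain ⟨x⟩ := x
  obtain ⟨y⟩ := y
  exact (Submodule.Quotient.eq _).mpr (semiBracket_sub_semiBracket_mem hI
    (RelFree.compatible_pullbackEval hI fr.compatible_pushforward x)
    (RelFree.compatible_pullbackEval hI fr.compatible_pushforward y)
    ((Submodule.Quotient.eq _).mp h) ((Submodule.Quotient.eq _).mp h'))

end Represents

end AdaptedFrame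

end Transport

/-! ### Change of coefficients -/

theorem FreeLieAlgebra.lift_mem_of_mem {k X L L' : Type*} [CommRing k] [LieRing L] [LieAlgebra k L]
    [LieRing L'] [LieAlgebra k L'] (S : LieSubalgebra k (L × L')) {f : X → L} {g : X → L'}
    (h : ∀ i, (f i, g i) ∈ S) (w : FreeLieAlgebra k X) :
    (FreeLieAlgebra.lift k f w, FreeLieAlgebra.lift k g w) ∈ S := by
  let F : FreeLieAlgebra k X →ₗ⁅k⁆ S := FreeLieAlgebra.lift k fun i => ⟨(f i, g i), h i⟩
  have h₁ : (LieHom.fst k L L').comp (S.incl.comp F) = FreeLieAlgebra.lift k f :=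
    FreeLieAlgebra.hom_ext fun i => by simp [F]
  have h₂ : (LieHom.snd k L L').comp (S.incl.comp F) = FreeLieAlgebra.lift k g :=
    FreeLieAlgebra.hom_ext fun i => by simp [F]
  rw [← h₁, ← h₂]
  exact (F w).2

section CoeffMap

variable {k A B C L : Type*} [CommRing k] [CommRing A] [Algebra k A] [CommRing B] [Algebra k B]
  [CommRing C] [Algebra k C] [LieRing L] [LieAlgebra k L]

theorem lie_mem_of_mem_span {S T : Set (A ⊗[k] L)} {U : Submodule A (A ⊗[k] L)}
    (h : ∀ s ∈ S, ∀ t ∈ T, ⁅s, t⁆ ∈ U) {w w' : A ⊗[k] L} (hw : w ∈ Submodule.span A S)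
    (hw' : w' ∈ Submodule.span A T) : ⁅w, w'⁆ ∈ U := by
  induction hw using Submodule.span_induction with
  | mem s hs =>
    induction hw' using Submodule.span_induction with
    | mem t ht => exact h s hs t ht
    | zero => simp
    | add x y _ _ hx hy => simpa using add_mem hx hy
    | smul a x _ hx => simpa using U.smul_mem a hx
  | zero => simp
  | add x y _ _ hx hy => simpa using add_mem hx hy
  | smul a x _ hx => simpa using U.smul_mem a hx

/-- Extension of the coefficients along `σ : B → A`. -/
noncomputable def coeffMap (L : Type*) [LieRing L] [LieAlgebra k L] (σ : B →ₐ[k] A) :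
    B ⊗[k] L →ₗ⁅k⁆ A ⊗[k] L :=
  LieAlgebra.ExtendScalars.map σ LieHom.id

@[simp]
theorem coeffMap_tmul (σ : B →ₐ[k] A) (b : B) (s : L) :
    coeffMap L σ (b ⊗ₜ[k] s) = σ b ⊗ₜ[k] s := rfl

theorem coeffMap_smul (σ : B →ₐ[k] A) (b : B) (z : B ⊗[k] L) :
    coeffMap L σ (b • z) = σ b • coeffMap L σ z := by
  induction z with
  | zero => simp
  | add x y hx hy => simp only [smul_add, map_add, hx, hy]
  | tmul c s => simp [TensorProduct.smul_tmul']

/-- The second component of a bracket in `Der A ⋉ (A ⊗ L)`, compared with the brackets in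
`Der B ⋉ (B ⊗ L)`, for elements whose second components are extended from `B`. The difference
vanishes if `D - ∑ i, f i • E i` and `D' - ∑ j, f' j • E' j` vanish on `B`. -/
theorem semiBracket_sum_coeffMap {ι κ : Type*} [Fintype ι] [Fintype κ] (σ : B →ₐ[k] A)
    (D D' : Derivation k A A) (f : ι → A) (f' : κ → A) (E : ι → Derivation k B B)
    (E' : κ → Derivation k B B) (z : ι → B ⊗[k] L) (z' : κ → B ⊗[k] L) :
    semiBracket D (∑ i, f i • coeffMap L σ (z i)) D' (∑ j, f' j • coeffMap L σ (z' j)) -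
      (∑ i, ∑ j, (f i * f' j) • coeffMap L σ (semiBracket (E i) (z i) (E' j) (z' j)) +
        ∑ j, D (f' j) • coeffMap L σ (z' j) - ∑ i, D' (f i) • coeffMap L σ (z i)) =
      ∑ j, f' j • (coeffAct L D (coeffMap L σ (z' j)) -
        ∑ i, f i • coeffMap L σ (coeffAct L (E i) (z' j))) -
      ∑ i, f i • (coeffAct L D' (coeffMap L σ (z i)) -
        ∑ j, f' j • coeffMap L σ (coeffAct L (E' j) (z i))) := by
  have h1 : ∑ j, ∑ i, (f i * f' j) • coeffMap L σ (coeffAct L (E i) (z' j)) =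
      ∑ i, ∑ j, (f i * f' j) • coeffMap L σ (coeffAct L (E i) (z' j)) := Finset.sum_comm
  simp only [semiBracket, sum_lie_sum, smul_lie, lie_smul, map_sum, coeffAct_smul, map_add, map_sub,
    smul_add, smul_sub, Finset.sum_add_distrib, Finset.sum_sub_distrib, Finset.smul_sum, smul_smul,
    LieHom.map_lie, mul_comm (f' _), h1]
  abel

section PullAnchor

variable [Module C L] {σ : B →ₐ[k] A} {τ : C →ₐ[k] B}

theorem pullAnchor_coeffMap [LieRingModule L C] [LieRinehartRing C L] [LieRinehartAlgebra k C L]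
    (c : C) (z : B ⊗[k] L) :
    pullAnchor (σ.comp τ) c (coeffMap L σ z) = σ (pullAnchor τ c z) := by
  induction z with
  | zero => simp
  | add x y hx hy => simp only [map_add, hx, hy]
  | tmul b s => simp

end PullAnchor

end CoeffMap

namespace RelFree

variable {k A 𝔤 M : Type*} [CommRing k] [CommRing A] [Algebra k A]
  [LieRing 𝔤] [Module A 𝔤] [LieRingModule 𝔤 A] [LieRinehartRing A 𝔤]
  [LieAlgebra k 𝔤] [LieRinehartAlgebra k A 𝔤]
  [AddCommGroup M] [Module A M] [LieRingModule 𝔤 M] [AnchoredModule k A 𝔤 M]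

theorem induction {motive : RelFree k A 𝔤 M → Prop} (of : ∀ m, motive (of k A 𝔤 M m))
    (zero : motive 0) (add : ∀ x y, motive x → motive y → motive (x + y))
    (smul : ∀ (f : A) x, motive x → motive (f • x))
    (lie : ∀ x y, motive x → motive y → motive ⁅x, y⁆) (x : RelFree k A 𝔤 M) : motive x := by
  obtain ⟨x⟩ := x
  induction x with
  | of m => exact of m
  | zero => exact zero
  | add x y hx hy => exact add _ _ hx hy
  | smul f x hx => exact smul f _ hx
  | lie x y hx hy => exact lie _ _ hx hy

theorem FiltLE.mono {d e : ℕ} {x : RelFree k A 𝔤 M} (h : FiltLE k A 𝔤 M d x) (hde : d ≤ e) :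
    FiltLE k A 𝔤 M e x := by
  induction h generalizing e with
  | of m hd => exact .of m (hd.trans hde)
  | zero => exact .zero
  | add _ _ hx hy => exact .add (hx hde) (hy hde)
  | smul f _ hx => exact .smul f (hx hde)
  | lie hx hy hd _ _ => exact .lie hx hy (hd.trans hde)

end RelFree

namespace AdaptedFrame

variable {k A B C 𝔤 M 𝔥 N 𝔯 R : Type*} [CommRing k] [CommRing A] [Algebra k A]
  [CommRing B] [Algebra k B] [CommRing C] [Algebra k C]
  [LieRing 𝔤] [Module A 𝔤] [LieRingModule 𝔤 A] [LieRinehartRing A 𝔤]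
  [LieAlgebra k 𝔤] [LieRinehartAlgebra k A 𝔤]
  [AddCommGroup M] [Module A M] [LieRingModule 𝔤 M] [AnchoredModule k A 𝔤 M]
  [LieRing 𝔥] [Module B 𝔥] [LieRingModule 𝔥 B] [LieRinehartRing B 𝔥]
  [LieAlgebra k 𝔥] [LieRinehartAlgebra k B 𝔥]
  [AddCommGroup N] [Module B N] [LieRingModule 𝔥 N] [AnchoredModule k B 𝔥 N]
  [LieRing 𝔯] [Module C 𝔯] [LieRingModule 𝔯 C] [LieRinehartRing C 𝔯]
  [LieAlgebra k 𝔯] [LieRinehartAlgebra k C 𝔯]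
  [AddCommGroup R] [Module C R] [LieRingModule 𝔯 R] [AnchoredModule k C 𝔯 R]

/-! ### Properties of the transport map -/

section Filtration

variable (k A 𝔥 N) in
/-- The `A`-submodule of `A ⊗ R(N, 𝔥)` generated by `R(N, 𝔥)_{≤ d}`. -/
noncomputable def filtSpan (d : ℕ) : Submodule A (A ⊗[k] RelFree k B 𝔥 N) :=
  Submodule.span A {w | ∃ y, RelFree.FiltLE k B 𝔥 N d y ∧ w = 1 ⊗ₜ[k] y}

theorem tmul_mem_filtSpan {d : ℕ} (a : A) {y : RelFree k B 𝔥 N} (hy : RelFree.FiltLE k B 𝔥 N d y) :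
    a ⊗ₜ[k] y ∈ filtSpan k A 𝔥 N d := by
  have h := (filtSpan k A 𝔥 N d).smul_mem a (Submodule.subset_span ⟨y, hy, rfl⟩)
  simpa [TensorProduct.smul_tmul'] using h

theorem filtSpan_mono {d e : ℕ} (hde : d ≤ e) :
    filtSpan k A 𝔥 N (B := B) d ≤ filtSpan k A 𝔥 N e := by
  refine Submodule.span_mono ?_
  rintro _ ⟨y, hy, rfl⟩
  exact ⟨y, hy.mono hde, rfl⟩

theorem coeffAct_mem_filtSpan {d : ℕ} (D : Derivation k A A) {w : A ⊗[k] RelFree k B 𝔥 N}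
    (hw : w ∈ filtSpan k A 𝔥 N d) : coeffAct _ D w ∈ filtSpan k A 𝔥 N d := by
  induction hw using Submodule.span_induction with
  | mem x hx =>
    obtain ⟨y, -, rfl⟩ := hx
    simp
  | zero => simp
  | add x y _ _ hx hy => simpa using add_mem hx hy
  | smul a x hx' hx =>
    rw [coeffAct_smul]
    exact add_mem (Submodule.smul_mem _ _ hx) (Submodule.smul_mem _ _ hx')

theorem lie_mem_filtSpan {i j : ℕ} {w w' : A ⊗[k] RelFree k B 𝔥 N}
    (hw : w ∈ filtSpan k A 𝔥 N i) (hw' : w' ∈ filtSpan k A 𝔥 N j) :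
    ⁅w, w'⁆ ∈ filtSpan k A 𝔥 N (i + j) := by
  refine lie_mem_of_mem_span ?_ hw hw'
  rintro _ ⟨y, hy, rfl⟩ _ ⟨y', hy', rfl⟩
  exact tmul_mem_filtSpan _ (hy.lie hy' le_rfl)

variable {σ : B →ₐ[k] A} {I : Ideal A} {fr : AdaptedFrame k 𝔤 M 𝔥 N σ I}
  {hI : ∀ D : Derivation k A A, ∀ a ∈ I, D a ∈ I}

theorem exists_represents_of_filtLE {d : ℕ} {x : RelFree k A 𝔤 M}
    (hx : RelFree.FiltLE k A 𝔤 M d x) :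
    ∃ w ∈ filtSpan k A 𝔥 N d, fr.Represents hI x w := by
  induction hx with
  | of m hd =>
    refine ⟨fr.pushforward m, ?_, .of (fr.pushforward_mem m) (fr.compatible_pushforward m)⟩
    exact Submodule.sum_mem _ fun j _ => tmul_mem_filtSpan _ (.of _ hd)
  | zero => exact ⟨0, zero_mem _, .zero⟩
  | add _ _ hx hy =>
    obtain ⟨w, hw, h⟩ := hx
    obtain ⟨w', hw', h'⟩ := hy
    exact ⟨w + w', add_mem hw hw', h.add h'⟩
  | smul f _ hx =>
    obtain ⟨w, hw, h⟩ := hx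
    exact ⟨f • w, Submodule.smul_mem _ f hw, h.smul f⟩
  | @lie i j d _ _ _ _ hd hx hy =>
    obtain ⟨w, hw, h⟩ := hx
    obtain ⟨w', hw', h'⟩ := hy
    refine ⟨_, ?_, h.lie h'⟩
    exact sub_mem (add_mem (filtSpan_mono hd (lie_mem_filtSpan hw hw'))
      (filtSpan_mono (by omega) (coeffAct_mem_filtSpan _ hw')))
      (filtSpan_mono (by omega) (coeffAct_mem_filtSpan _ hw))

end Filtration

section Related

variable {σ : B →ₐ[k] A} {I : Ideal A} {fr : AdaptedFrame k 𝔤 M 𝔥 N σ I}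
  {hI : ∀ D : Derivation k A A, ∀ a ∈ I, D a ∈ I}

theorem Represents.lie_one_tmul {x x' : RelFree k A 𝔤 M} {y y' : RelFree k B 𝔥 N}
    (h : fr.Represents hI x (1 ⊗ₜ y)) (h' : fr.Represents hI x' (1 ⊗ₜ y')) :
    fr.Represents hI ⁅x, x'⁆ (1 ⊗ₜ ⁅y, y'⁆) := by
  simpa [semiBracket] using h.lie h'

theorem represents_of_one_tmul {m : M} {η : N}
    (h : ∀ b, AnchoredModule.anchor (k := k) 𝔤 m (σ b) -
      σ (AnchoredModule.anchor (k := k) 𝔥 η b) ∈ I) :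
    fr.Represents hI (RelFree.of k A 𝔤 M m) (1 ⊗ₜ RelFree.of k B 𝔥 N η) :=
  .of (tmul_of_mem_generatorSpan 1 η) fun b => by simpa [RelFree.of_lie_eq] using h b

/-- Iterated brackets of elements of `M` that are related to elements of `N` are represented by the
iterated brackets of these elements. -/
theorem represents_lift {X : Type*} {m : X → M} {η : X → N}
    (h : ∀ i b, AnchoredModule.anchor (k := k) 𝔤 (m i) (σ b) -
      σ (AnchoredModule.anchor (k := k) 𝔥 (η i) b) ∈ I) (w : FreeLieAlgebra k X) :
    fr.Represents hI (FreeLieAlgebra.lift k (fun i => RelFree.of k A 𝔤 M (m i)) w)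
      (1 ⊗ₜ FreeLieAlgebra.lift k (fun i => RelFree.of k B 𝔥 N (η i)) w) := by
  let S : LieSubalgebra k (RelFree k A 𝔤 M × RelFree k B 𝔥 N) :=
    { carrier := {p | fr.Represents hI p.1 (1 ⊗ₜ p.2)}
      zero_mem' := by
        change fr.Represents hI 0 (1 ⊗ₜ 0)
        rw [TensorProduct.tmul_zero]
        exact .zero
      add_mem' := by
        rintro ⟨x, y⟩ ⟨x', y'⟩ h h'
        change fr.Represents hI (x + x') (1 ⊗ₜ (y + y'))
        rw [TensorProduct.tmul_add]
        exact h.add h'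
      smul_mem' := by
        rintro c ⟨x, y⟩ h
        change fr.Represents hI (algebraMap k A c • x) (1 ⊗ₜ (c • y))
        rw [TensorProduct.tmul_smul, ← algebraMap_smul A c]
        exact h.smul _
      lie_mem' := by
        rintro ⟨x, y⟩ ⟨x', y'⟩ h h'
        exact h.lie_one_tmul h' }
  exact FreeLieAlgebra.lift_mem_of_mem S (fun i => represents_of_one_tmul (h i)) w

end Related

theorem represents_id {σ : A →ₐ[k] A} {I : Ideal A} {fr : AdaptedFrame k 𝔤 M 𝔤 M σ I}
    {hI : ∀ D : Derivation k A A, ∀ a ∈ I, D a ∈ I} (hσ : ∀ a, σ a = a) (x : RelFree k A 𝔤 M) :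
    fr.Represents hI x (1 ⊗ₜ x) := by
  induction x using RelFree.induction with
  | of m => exact represents_of_one_tmul fun b => by simp [hσ]
  | zero =>
    rw [TensorProduct.tmul_zero]
    exact .zero
  | add x y hx hy =>
    rw [TensorProduct.tmul_add]
    exact hx.add hy
  | smul f x hx =>
    refine (hx.smul f).congr ?_
    have h := balance_mem (k := k) (σ := σ) (I := I) 1 f x
    simpa [hσ, TensorProduct.smul_tmul'] using h
  | lie x y hx hy => exact hx.lie_one_tmul hy

/-- If every element of `M` has the same representative with respect to almost all members of a
family of frames, then so does every element of `R(M, 𝔤)`. -/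
theorem exists_eventually_represents {P : Type*} {l : Filter P} {σ : B →ₐ[k] A} {I : P → Ideal A}
    {hI : ∀ p, ∀ D : Derivation k A A, ∀ a ∈ I p, D a ∈ I p}
    {fr : ∀ p, AdaptedFrame k 𝔤 M 𝔥 N σ (I p)}
    (h : ∀ m : M, ∃ w ∈ generatorSpan k A 𝔥 N (B := B), ∀ᶠ p in l,
      Compatible σ (I p) (AnchoredModule.anchor 𝔤 m) w) (x : RelFree k A 𝔤 M) :
    ∃ w, ∀ᶠ p in l, (fr p).Represents (hI p) x w := by
  induction x using RelFree.induction with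
  | of m =>
    obtain ⟨w, hw, hm⟩ := h m
    exact ⟨w, hm.mono fun p hp => .of hw hp⟩
  | zero => exact ⟨0, .of_forall fun p => .zero⟩
  | add x y hx hy =>
    obtain ⟨w, hx⟩ := hx
    obtain ⟨w', hy⟩ := hy
    exact ⟨w + w', (hx.and hy).mono fun p hp => hp.1.add hp.2⟩
  | smul f x hx =>
    obtain ⟨w, hx⟩ := hx
    exact ⟨f • w, hx.mono fun p hp => hp.smul f⟩
  | lie x y hx hy =>
    obtain ⟨w, hx⟩ := hx
    obtain ⟨w', hy⟩ := hy
    exact ⟨_, (hx.and hy).mono fun p hp => hp.1.lie hp.2⟩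

section Composition

variable {σ : B →ₐ[k] A} {τ : C →ₐ[k] B} {I : Ideal A} {J : Ideal B}
  {hI : ∀ D : Derivation k A A, ∀ a ∈ I, D a ∈ I} {hJ : ∀ D : Derivation k B B, ∀ b ∈ J, D b ∈ J}
  {fr : AdaptedFrame k 𝔤 M 𝔥 N σ I} {fr' : AdaptedFrame k 𝔥 N 𝔯 R τ J}
  {ρ : C →ₐ[k] A} {frc : AdaptedFrame k 𝔤 M 𝔯 R ρ I}

theorem coeffMap_mem_generatorSpan {z : B ⊗[k] RelFree k C 𝔯 R}
    (hz : z ∈ generatorSpan k B 𝔯 R (B := C)) :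
    coeffMap _ σ z ∈ generatorSpan k A 𝔯 R (B := C) := by
  induction hz using Submodule.span_induction with
  | mem x hx =>
    obtain ⟨η, rfl⟩ := hx
    exact tmul_of_mem_generatorSpan _ _
  | zero => simp
  | add x y _ _ hx hy => simpa using add_mem hx hy
  | smul b x _ hx => simpa [coeffMap_smul] using Submodule.smul_mem _ (σ b) hx

/-- If `D` acts on `B` as `∑ f i • y i` does, it acts in the same way on coefficients that are
extended from `B`. -/
theorem coeffAct_coeffMap_sub_mem {ι : Type*} [Fintype ι] {D : Derivation k A A} {f : ι → A}
    {y : ι → RelFree k B 𝔥 N} (h : Compatible σ I D (∑ i, f i ⊗ₜ[k] y i))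
    (z : B ⊗[k] RelFree k C 𝔯 R) :
    coeffAct _ D (coeffMap _ σ z) -
      ∑ i, f i • coeffMap _ σ (coeffAct _ (RelFree.anchorFun k B 𝔥 N (y i)) z) ∈
        balancing k (RelFree k C 𝔯 R) (σ.comp τ) I := by
  induction z with
  | zero => simp
  | add x y hx hy =>
    simp only [map_add, smul_add, Finset.sum_add_distrib]
    convert add_mem hx hy using 1
    abel
  | tmul b s =>
    convert ideal_tmul_mem (h b) s using 1
    simp only [coeffMap_tmul, coeffAct_tmul, map_sum, pullAnchor_tmul, TensorProduct.sub_tmul,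
      TensorProduct.sum_tmul, TensorProduct.smul_tmul', smul_eq_mul]
    rfl

/-- The image under a composite is computed in two steps: an element `x` is represented over `B`
by `∑ f i ⊗ y i`, and over `C` by what is obtained on replacing each `y i` by a
representative `z i` over `C`. -/
theorem exists_represents_comp (hρ : ρ = σ.comp τ) (hJI : ∀ b ∈ J, σ b ∈ I) (x : RelFree k A 𝔤 M) :
    ∃ (ι : Type) (_ : Fintype ι) (f : ι → A) (y : ι → RelFree k B 𝔥 N)
      (z : ι → B ⊗[k] RelFree k C 𝔯 R),
      fr.Represents hI x (∑ i, f i ⊗ₜ[k] y i) ∧ (∀ i, fr'.Represents hJ (y i) (z i)) ∧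
        frc.Represents hI x (∑ i, f i • coeffMap _ σ (z i)) := by
  subst hρ
  induction x using RelFree.induction with
  | of m =>
    refine ⟨fr.ι, inferInstance, _, _, fun j => fr'.pushforward (fr.field j),
      .of (fr.pushforward_mem m) (fr.compatible_pushforward m),
      fun j => .of (fr'.pushforward_mem _) (fr'.compatible_pushforward _), .of ?_ ?_⟩
    · exact Submodule.sum_mem _ fun j _ => Submodule.smul_mem _ _
        (coeffMap_mem_generatorSpan (fr'.pushforward_mem _))
    · intro c
      have h1 := fr.chain m (τ c)
      have h2 : ∑ j, AnchoredModule.anchor (k := k) 𝔤 m (σ (fr.coord j)) *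
          σ (AnchoredModule.anchor (k := k) 𝔥 (fr.field j) (τ c) -
            pullAnchor τ c (fr'.pushforward (fr.field j))) ∈ I :=
        Submodule.sum_mem _ fun j _ =>
          I.mul_mem_left _ (hJI _ (fr'.compatible_pushforward (fr.field j) c))
      convert add_mem h1 h2 using 1
      simp only [map_sum, map_smul, pullAnchor_coeffMap, smul_eq_mul, map_sub, mul_sub,
        Finset.sum_sub_distrib, AlgHom.comp_apply]
      ring
  | zero => exact ⟨Empty, inferInstance, Empty.elim, Empty.elim, Empty.elim, by simpa using .zero,
      by simp, by simpa using .zero⟩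
  | add x y hx hy =>
    obtain ⟨ι, _, f, y, z, h1, h2, h3⟩ := hx
    obtain ⟨ι', _, f', y', z', h1', h2', h3'⟩ := hy
    refine ⟨ι ⊕ ι', inferInstance, Sum.elim f f', Sum.elim y y', Sum.elim z z', ?_, ?_, ?_⟩
    · simpa using h1.add h1'
    · rintro (i | i)
      exacts [h2 i, h2' i]
    · simpa using h3.add h3'
  | smul a x hx =>
    obtain ⟨ι, _, f, y, z, h1, h2, h3⟩ := hx
    refine ⟨ι, inferInstance, fun i => a * f i, y, z, ?_, h2, ?_⟩
    · simpa [Finset.smul_sum, TensorProduct.smul_tmul'] using h1.smul a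
    · simpa [Finset.smul_sum, smul_smul] using h3.smul a
  | lie x x' hx hx' =>
    obtain ⟨ι, _, f, y, z, h1, h2, h3⟩ := hx
    obtain ⟨ι', _, f', y', z', h1', h2', h3'⟩ := hx'
    set D := RelFree.anchorFun k A 𝔤 M x
    set D' := RelFree.anchorFun k A 𝔤 M x'
    -- The three kinds of terms of the bracket of `∑ f i ⊗ y i` and `∑ f' j ⊗ y' j` in
    -- `Der A ⋉ (A ⊗ L)`: brackets of vectors, and derivatives of either family of coefficients.
    refine ⟨(ι × ι') ⊕ (ι' ⊕ ι), inferInstance,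
      Sum.elim (fun p => f p.1 * f' p.2) (Sum.elim (fun j => D (f' j)) (fun i => -D' (f i))),
      Sum.elim (fun p => ⁅y p.1, y' p.2⁆) (Sum.elim y' y),
      Sum.elim (fun p => semiBracket (RelFree.anchorFun k B 𝔥 N (y p.1)) (z p.1)
        (RelFree.anchorFun k B 𝔥 N (y' p.2)) (z' p.2)) (Sum.elim z' z), ?_, ?_, ?_⟩
    · refine (h1.lie h1').congr ?_
      convert (balancing k (RelFree k B 𝔥 N) σ I).zero_mem using 1
      rw [semiBracket, lie_sum_tmul]
      simp only [Fintype.sum_sum_type, Fintype.sum_prod_type, Sum.elim_inl, Sum.elim_inr,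
        map_sum, coeffAct_tmul, TensorProduct.neg_tmul, Finset.sum_neg_distrib]
      abel
    · rintro (⟨i, j⟩ | j | i)
      exacts [(h2 i).lie (h2' j), h2' j, h2 i]
    · refine (h3.lie h3').congr ?_
      have key := semiBracket_sum_coeffMap σ D D' f f'
        (fun i => RelFree.anchorFun k B 𝔥 N (y i)) (fun j => RelFree.anchorFun k B 𝔥 N (y' j)) z z'
      simp only [Fintype.sum_sum_type, Fintype.sum_prod_type, Sum.elim_inl, Sum.elim_inr,
        neg_smul, Finset.sum_neg_distrib]
      rw [← add_assoc, ← sub_eq_add_neg, key]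
      exact sub_mem
        (Submodule.sum_mem _ fun j _ => Submodule.smul_mem _ _
          (coeffAct_coeffMap_sub_mem h1.compatible _))
        (Submodule.sum_mem _ fun i _ => Submodule.smul_mem _ _
          (coeffAct_coeffMap_sub_mem h1'.compatible _))

end Composition

end AdaptedFrame

/-! ### Point derivations of the algebra of smooth functions -/

section Hadamard

variable {E : Type*} [NormedAddCommGroup E] [NormedSpace ℝ E]

open MeasureTheory in
theorem contDiff_integral_Icc_zero_one {P G : Type*} [NormedAddCommGroup P] [NormedSpace ℝ P]
    [NormedAddCommGroup G] [NormedSpace ℝ G] {f : P × ℝ → G} (hf : ContDiff ℝ ∞ f) :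
    ContDiff ℝ ∞ fun x => ∫ t in Set.Icc (0 : ℝ) 1, f (x, t) := by
  -- The integral is the value at `0` of the convolution of the indicator function of `[0, 1]` with
  -- `s ↦ χ s • f (x, -s)`, where the cutoff function `χ` is equal to `1` on `[-1, 1]`.
  let χ : ContDiffBump (0 : ℝ) := ⟨1, 2, one_pos, one_lt_two⟩
  have h := contDiffOn_convolution_right_with_param_comp (n := ⊤) (μ := volume)
    (ContinuousLinearMap.lsmul ℝ ℝ (E := G)) (s := (Set.univ : Set P)) (v := fun _ => (0 : ℝ))
    contDiffOn_const (f := Set.indicator (Set.Icc 0 1) fun _ => 1)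
    (g := fun x s => χ s • f (x, -s)) (k := Metric.closedBall 0 2) isOpen_univ
    (isCompact_closedBall _ _) ?_ ?_ ?_
  · convert contDiffOn_univ.mp h using 2 with x
    rw [← MeasureTheory.integral_indicator measurableSet_Icc, MeasureTheory.convolution]
    congr 1
    ext t
    by_cases ht : t ∈ Set.Icc (0 : ℝ) 1
    · have : χ (-t) = 1 := χ.one_of_mem_closedBall (by
        simp only [mem_closedBall_zero_iff, norm_neg, Real.norm_eq_abs]
        exact abs_le.mpr ⟨by linarith [ht.1], ht.2⟩)
      simp [ht, this]
    · simp [ht]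
  · intro x s _ hs
    have : χ s = 0 := χ.zero_of_le_dist (by
      simpa using (not_le.mp (mt Metric.mem_closedBall.mpr hs)).le)
    simp [this]
  · exact (locallyIntegrable_const (1 : ℝ)).indicator measurableSet_Icc
  · refine ContDiff.contDiffOn ?_
    exact (χ.contDiff.comp contDiff_snd).smul
      (hf.comp (contDiff_fst.prodMk contDiff_snd.neg))

/-- Hadamard's lemma, with all partial derivatives of `H` along the segment from `z` to `x` averaged
into one smooth family of functionals. -/
theorem exists_hadamard {H : E → ℝ} (hH : ContDiff ℝ ∞ H) (z : E) :
    ∃ G : E → E →L[ℝ] ℝ, ContDiff ℝ ∞ G ∧ (∀ x, H x = H z + G x (x - z)) ∧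
      G z = fderiv ℝ H z := by
  have hD : ContDiff ℝ ∞ (fderiv ℝ H) := hH.fderiv_right (by simp)
  have hf : ContDiff ℝ ∞ fun p : E × ℝ => fderiv ℝ H (z + p.2 • (p.1 - z)) :=
    hD.comp (contDiff_const.add (contDiff_snd.smul (contDiff_fst.sub contDiff_const)))
  refine ⟨_, contDiff_integral_Icc_zero_one hf, fun x => ?_, ?_⟩
  · have hcont : Continuous fun t : ℝ => fderiv ℝ H (z + t • (x - z)) :=
      hf.continuous.comp (Continuous.prodMk_right x)
    have h1 : ∀ t ∈ Set.uIcc (0 : ℝ) 1, HasDerivAt (fun t : ℝ => H (z + t • (x - z)))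
        (fderiv ℝ H (z + t • (x - z)) (x - z)) t := by
      intro t _
      have h2 : HasDerivAt (fun t : ℝ => z + t • (x - z)) (x - z) t := by
        simpa using ((hasDerivAt_id t).smul_const (x - z)).const_add z
      exact (hH.differentiable (by simp) _).hasFDerivAt.comp_hasDerivAt t h2
    have h2 := intervalIntegral.integral_eq_sub_of_hasDerivAt h1
      ((hcont.clm_apply continuous_const).intervalIntegrable _ _)
    rw [intervalIntegral.integral_of_le zero_le_one,
      ← MeasureTheory.integral_Icc_eq_integral_Ioc] at h2
    rw [ContinuousLinearMap.integral_apply (hcont.integrableOn_Icc), h2]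
    simp
  · simp

end Hadamard

section Germs

variable {E : Type*} [NormedAddCommGroup E] [NormedSpace ℝ E]
  {M : Type*} [TopologicalSpace M] [ChartedSpace E M]

theorem contMDiff_cutoff_mul {ρ f : M → ℝ} {U : Set M}
    (hρ : ContMDiff 𝓘(ℝ, E) 𝓘(ℝ) ∞ ρ) (hU : IsOpen U) (hsupp : tsupport ρ ⊆ U)
    (hf : ContMDiffOn 𝓘(ℝ, E) 𝓘(ℝ) ∞ f U) :
    ContMDiff 𝓘(ℝ, E) 𝓘(ℝ) ∞ fun x => ρ x * f x := by
  refine contMDiff_of_tsupport fun x hx => ?_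
  have hxU : x ∈ U := hsupp (closure_mono (Function.support_mul_subset_left ρ f) hx)
  exact hρ.contMDiffAt.mul (hf.contMDiffAt (hU.mem_nhds hxU))

/-- The ideal of smooth functions that vanish near `p`. -/
def germIdeal (E : Type*) [NormedAddCommGroup E] [NormedSpace ℝ E] {M : Type*} [TopologicalSpace M]
    [ChartedSpace E M] (p : M) : Ideal C^∞⟮𝓘(ℝ, E), M; ℝ⟯ where
  carrier := {f | ∀ᶠ z in 𝓝 p, f z = 0}
  add_mem' hf hg := (hf.and hg).mono fun z hz => by
    change _ + _ = (0 : ℝ)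
    rw [hz.1, hz.2, add_zero]
  zero_mem' := .of_forall fun _ => rfl
  smul_mem' c f hf := hf.mono fun z hz => by
    change c z * f z = 0
    rw [hz, mul_zero]

/-- A point derivation at `z` on the algebra of smooth functions. -/
def IsPointDerivation (z : M) (v : C^∞⟮𝓘(ℝ, E), M; ℝ⟯ →ₗ[ℝ] ℝ) : Prop :=
  ∀ f g, v (f * g) = f z * v g + g z * v f

theorem IsPointDerivation.map_const {z : M} {v : C^∞⟮𝓘(ℝ, E), M; ℝ⟯ →ₗ[ℝ] ℝ}
    (hv : IsPointDerivation z v) (c : ℝ) :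
    v (algebraMap ℝ C^∞⟮𝓘(ℝ, E), M; ℝ⟯ c) = 0 := by
  have h1 := hv 1 1
  rw [mul_one] at h1
  have h2 : v 1 = 0 := by
    change v 1 = 1 * v 1 + 1 * v 1 at h1
    linarith
  rw [Algebra.algebraMap_eq_smul_one, map_smul, h2, smul_zero]

theorem contDiffOn_comp_chart_symm {Φ : OpenPartialHomeomorph M E}
    (hΦ : Φ ∈ IsManifold.maximalAtlas 𝓘(ℝ, E) ∞ M) (h : C^∞⟮𝓘(ℝ, E), M; ℝ⟯) :
    ContDiffOn ℝ ∞ (h ∘ Φ.symm) Φ.target :=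
  (h.contMDiff.comp_contMDiffOn (contMDiffOn_symm_of_mem_maximalAtlas hΦ)).contDiffOn

/-- The constant vector field `w` in a chart, cut off by `ρ`. -/
noncomputable def chartField {Φ : OpenPartialHomeomorph M E}
    (hΦ : Φ ∈ IsManifold.maximalAtlas 𝓘(ℝ, E) ∞ M)
    (ρ : C^∞⟮𝓘(ℝ, E), M; ℝ⟯) (hρ : tsupport ρ ⊆ Φ.source) (w : E) :
    Derivation ℝ C^∞⟮𝓘(ℝ, E), M; ℝ⟯ C^∞⟮𝓘(ℝ, E), M; ℝ⟯ :=
  have hd : ∀ (h : C^∞⟮𝓘(ℝ, E), M; ℝ⟯) (x : M), x ∈ tsupport ρ →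
      DifferentiableAt ℝ (h ∘ Φ.symm) (Φ x) := fun h x hx =>
    ((contDiffOn_comp_chart_symm hΦ h).contDiffAt
      (Φ.open_target.mem_nhds (Φ.map_source (hρ hx)))).differentiableAt (by simp)
  have h0 : ∀ (x : M), x ∉ tsupport ρ → ρ x = 0 := fun x hx => image_eq_zero_of_notMem_tsupport hx
  Derivation.mk'
    { toFun := fun h => ⟨fun x => ρ x * fderiv ℝ (h ∘ Φ.symm) (Φ x) w,
        contMDiff_cutoff_mul ρ.contMDiff Φ.open_source hρ
          ((((contDiffOn_comp_chart_symm hΦ h).fderiv_of_isOpen Φ.open_target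
            (by simp)).clm_apply contDiffOn_const).contMDiffOn.comp
              (contMDiffOn_of_mem_maximalAtlas hΦ) fun x hx => Φ.map_source hx)⟩
      map_add' := fun f g => by
        ext x
        change ρ x * _ = ρ x * _ + ρ x * _
        by_cases hx : x ∈ tsupport ρ
        · have : (⇑(f + g) ∘ Φ.symm) = (f ∘ Φ.symm) + (g ∘ Φ.symm) := rfl
          rw [this, fderiv_add (hd f x hx) (hd g x hx), ← mul_add]
          rfl
        · simp [h0 x hx]
      map_smul' := fun c f => by
        ext x
        change ρ x * _ = c * (ρ x * _)
        by_cases hx : x ∈ tsupport ρ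
        · have : (⇑(c • f) ∘ Φ.symm) = c • (f ∘ Φ.symm) := rfl
          rw [this, fderiv_const_smul (hd f x hx)]
          exact mul_left_comm (ρ x) c _
        · simp [h0 x hx] }
    fun f g => by
      ext x
      change ρ x * _ = f x * (ρ x * _) + g x * (ρ x * _)
      by_cases hx : x ∈ tsupport ρ
      · have : (⇑(f * g) ∘ Φ.symm) = (f ∘ Φ.symm) * (g ∘ Φ.symm) := rfl
        rw [this, fderiv_mul (hd f x hx) (hd g x hx)]
        simp only [_root_.add_apply, _root_.smul_apply,
          Function.comp_apply, Φ.left_inv (hρ hx), smul_eq_mul]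
        ring
      · simp [h0 x hx]

theorem chartField_apply {Φ : OpenPartialHomeomorph M E}
    (hΦ : Φ ∈ IsManifold.maximalAtlas 𝓘(ℝ, E) ∞ M)
    (ρ : C^∞⟮𝓘(ℝ, E), M; ℝ⟯) (hρ : tsupport ρ ⊆ Φ.source) (w : E)
    (h : C^∞⟮𝓘(ℝ, E), M; ℝ⟯) (x : M) :
    chartField hΦ ρ hρ w h x = ρ x * fderiv ℝ (h ∘ Φ.symm) (Φ x) w := rfl

variable [FiniteDimensional ℝ E] [IsManifold 𝓘(ℝ, E) ∞ M] [T2Space M]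

theorem exists_smooth_cutoff {q : M} {U : Set M} (hU : U ∈ 𝓝 q) :
    ∃ ρ : C^∞⟮𝓘(ℝ, E), M; ℝ⟯, (∀ᶠ z in 𝓝 q, ρ z = 1) ∧ IsCompact (tsupport ρ) ∧
      tsupport ρ ⊆ U := by
  obtain ⟨f, -, hf⟩ := (SmoothBumpFunction.nhds_basis_tsupport (I := 𝓘(ℝ, E)) q).mem_iff.mp hU
  exact ⟨⟨f, f.contMDiff⟩, f.eventuallyEq_one, f.hasCompactSupport, hf⟩

namespace IsPointDerivation

variable {z : M} {v : C^∞⟮𝓘(ℝ, E), M; ℝ⟯ →ₗ[ℝ] ℝ}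

theorem eq_zero (hv : IsPointDerivation z v) {f : C^∞⟮𝓘(ℝ, E), M; ℝ⟯}
    (hf : ∀ᶠ x in 𝓝 z, f x = 0) : v f = 0 := by
  obtain ⟨ρ, h1, -, hρ⟩ := exists_smooth_cutoff (E := E) hf
  have h : f * ρ = 0 := by
    ext x
    by_cases hx : x ∈ tsupport ρ
    · change f x * ρ x = 0
      rw [show f x = 0 from hρ hx, zero_mul]
    · change f x * ρ x = 0
      rw [image_eq_zero_of_notMem_tsupport hx, mul_zero]
  have := hv f ρ
  rw [h, map_zero, h1.self_of_nhds, hf.self_of_nhds] at this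
  simpa using this.symm

theorem congr (hv : IsPointDerivation z v) {f g : C^∞⟮𝓘(ℝ, E), M; ℝ⟯}
    (h : ∀ᶠ x in 𝓝 z, f x = g x) : v f = v g := by
  rw [← sub_eq_zero, ← map_sub]
  refine hv.eq_zero (h.mono fun x hx => ?_)
  change f x - g x = 0
  rw [hx, sub_self]

end IsPointDerivation

/-- Derivations are local operators. -/
theorem Derivation.apply_mem_germIdeal (D : Derivation ℝ C^∞⟮𝓘(ℝ, E), M; ℝ⟯ C^∞⟮𝓘(ℝ, E), M; ℝ⟯)
    {p : M} {f : C^∞⟮𝓘(ℝ, E), M; ℝ⟯} (hf : f ∈ germIdeal E p) : D f ∈ germIdeal E p := by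
  refine (eventually_eventually_nhds.mpr hf).mono fun z hz => ?_
  let v : C^∞⟮𝓘(ℝ, E), M; ℝ⟯ →ₗ[ℝ] ℝ :=
    { toFun := fun h => D h z
      map_add' := fun a b => by rw [map_add]; rfl
      map_smul' := fun c a => by rw [map_smul]; rfl }
  have hv : IsPointDerivation z v := by
    intro a b
    change D (a * b) z = _
    rw [Derivation.leibniz]
    rfl
  exact hv.eq_zero hz

/-- The expansion of a point derivation in a chart: by Hadamard's lemma, the germ of `h` at `z` is a
constant plus a combination of the coordinates `y j - y j z`, whose coefficients have the partial
derivatives of `h` as values at `z`. -/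
theorem IsPointDerivation.eq_sum {Φ : OpenPartialHomeomorph M E}
    (hΦ : Φ ∈ IsManifold.maximalAtlas 𝓘(ℝ, E) ∞ M) {z : M} (hz : z ∈ Φ.source)
    {v : C^∞⟮𝓘(ℝ, E), M; ℝ⟯ →ₗ[ℝ] ℝ} (hv : IsPointDerivation z v)
    {ι : Type*} [Fintype ι] (b : Module.Basis ι ℝ E)
    {y : ι → C^∞⟮𝓘(ℝ, E), M; ℝ⟯} (hy : ∀ j, ∀ᶠ x in 𝓝 z, y j x = b.repr (Φ x) j)
    (h : C^∞⟮𝓘(ℝ, E), M; ℝ⟯) :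
    v h = ∑ j, v (y j) * fderiv ℝ (h ∘ Φ.symm) (Φ z) (b j) := by
  obtain ⟨ρ, hρ1, hρc, hρΦ⟩ := exists_smooth_cutoff (E := E) (Φ.open_source.mem_nhds hz)
  classical
  -- The function `ρ * h` in the chart, extended by zero.
  let H : E → ℝ := fun x => if x ∈ Φ.target then (ρ * h) (Φ.symm x) else 0
  have hHt : ∀ x ∈ Φ.target, H x = (ρ * h) (Φ.symm x) := fun x hx => if_pos hx
  have hH : ContDiff ℝ ∞ H := by
    rw [contDiff_iff_contDiffAt]
    intro x
    by_cases hx : x ∈ Φ.target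
    · refine ((contDiffOn_comp_chart_symm hΦ (ρ * h)).contDiffAt
        (Φ.open_target.mem_nhds hx)).congr_of_eventuallyEq ?_
      filter_upwards [Φ.open_target.mem_nhds hx] with w hw using hHt w hw
    · have hcl : IsClosed (Φ '' tsupport ρ) :=
        (hρc.image_of_continuousOn (Φ.continuousOn.mono hρΦ)).isClosed
      have hx' : x ∉ Φ '' tsupport ρ := by
        rintro ⟨w, hw, rfl⟩
        exact hx (Φ.map_source (hρΦ hw))
      refine (contDiffAt_const (c := (0 : ℝ))).congr_of_eventuallyEq ?_
      filter_upwards [hcl.isOpen_compl.mem_nhds hx'] with w hw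
      by_cases hwt : w ∈ Φ.target
      · rw [hHt w hwt]
        have : Φ.symm w ∉ tsupport ρ := fun hc => hw ⟨_, hc, Φ.right_inv hwt⟩
        change ρ _ * h _ = 0
        rw [image_eq_zero_of_notMem_tsupport this, zero_mul]
      · exact if_neg hwt
  have hHM : ∀ᶠ x in 𝓝 z, H (Φ x) = h x := by
    filter_upwards [hρ1, Φ.open_source.mem_nhds hz] with x hx hxs
    rw [hHt _ (Φ.map_source hxs), Φ.left_inv hxs]
    change ρ x * h x = h x
    rw [hx, one_mul]
  obtain ⟨G, hG, hHG, hGz⟩ := exists_hadamard hH (Φ z)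
  have hGd : G (Φ z) = fderiv ℝ (h ∘ Φ.symm) (Φ z) := by
    rw [hGz]
    refine Filter.EventuallyEq.fderiv_eq ?_
    have ht : Filter.Tendsto Φ.symm (𝓝 (Φ z)) (𝓝 z) := by
      simpa [Φ.left_inv hz] using (Φ.continuousAt_symm (Φ.map_source hz)).tendsto
    filter_upwards [ht.eventually hHM, Φ.open_target.mem_nhds (Φ.map_source hz)] with x hx hxt
    rwa [Φ.right_inv hxt] at hx
  let g : ι → C^∞⟮𝓘(ℝ, E), M; ℝ⟯ := fun j => ⟨fun x => ρ x * G (Φ x) (b j),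
    contMDiff_cutoff_mul ρ.contMDiff Φ.open_source hρΦ
      ((hG.clm_apply contDiff_const).contMDiff.comp_contMDiffOn
        (contMDiffOn_of_mem_maximalAtlas hΦ))⟩
  have hyz : ∀ j, y j z = b.repr (Φ z) j := fun j => (hy j).self_of_nhds
  -- Hadamard's formula for `h` in the chart, as an identity of germs of functions on `M`.
  have key : ∀ᶠ x in 𝓝 z, h x = (algebraMap ℝ C^∞⟮𝓘(ℝ, E), M; ℝ⟯ (h z) +
      ∑ j, (y j - algebraMap ℝ C^∞⟮𝓘(ℝ, E), M; ℝ⟯ (y j z)) * g j) x := by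
    filter_upwards [hHM, hρ1, Filter.eventually_all.mpr hy] with x hx hρx hyx
    have hsum : ∀ F : ι → C^∞⟮𝓘(ℝ, E), M; ℝ⟯, (∑ j, F j) x = ∑ j, F j x := fun F =>
      map_sum (ContMDiffMap.evalRingHom (I := 𝓘(ℝ, E)) (I' := 𝓘(ℝ, ℝ)) (n := ∞) (R := ℝ) x) F _
    change h x = h z + (∑ j, (y j - algebraMap ℝ C^∞⟮𝓘(ℝ, E), M; ℝ⟯ (y j z)) * g j) x
    rw [hsum, ← hx, hHG, hHM.self_of_nhds]
    congr 1
    conv_lhs => rw [← b.sum_repr (Φ x - Φ z), map_sum]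
    refine Finset.sum_congr rfl fun j _ => ?_
    change _ = (y j x - y j z) * (ρ x * G (Φ x) (b j))
    rw [hρx, hyx, hyz, map_smul, map_sub, one_mul]
    rfl
  rw [hv.congr key, map_add, hv.map_const, zero_add, map_sum]
  refine Finset.sum_congr rfl fun j _ => ?_
  rw [hv, map_sub, hv.map_const, sub_zero]
  change (y j z - y j z) * _ + (ρ z * G (Φ z) (b j)) * v (y j) = _
  rw [hρ1.self_of_nhds, hGd]
  ring

end Germs

/-! ### Coordinates adapted to a submersion -/

section SubmersionFrames

variable {m n : ℕ}
  {M : Type*} [TopologicalSpace M] [ChartedSpace (EuclideanSpace ℝ (Fin m)) M]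
  [IsManifold (𝓡 m) ∞ M] [T2Space M]
  {N : Type*} [TopologicalSpace N] [ChartedSpace (EuclideanSpace ℝ (Fin n)) N]
  [IsManifold (𝓡 n) ∞ N] [T2Space N]

/-- Adapted coordinates and coordinate vector fields near a point `q` of a submersion `F`, extended
to all of `M`: each field is vertical, or else its coordinate is a function on `N`. -/
theorem exists_adapted_coordinates {F : C^∞⟮𝓡 m, M; 𝓡 n, N⟯}
    (hF : Manifold.IsSubmersion (𝓡 m) (𝓡 n) ∞ F) (q : M) :
    ∃ (ι : Type) (_ : Fintype ι) (y : ι → C^∞⟮𝓡 m, M; ℝ⟯) (e : ι → SmoothVectorField m M),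
      (∀ j, e j ∈ verticalFields F ∨ ∃ g : C^∞⟮𝓡 n, N; ℝ⟯, y j = g.comp F) ∧
      ∀ᶠ z in 𝓝 q, ∀ v : C^∞⟮𝓡 m, M; ℝ⟯ →ₗ[ℝ] ℝ, IsPointDerivation z v →
        ∀ h, v h = ∑ j, v (y j) * e j h z := by
  obtain ⟨C, _, _, hF⟩ := hF
  obtain ⟨Φ, Ψ, hΦq, hΨq, hΦ, hΨ, hsub, a, ha⟩ := hF q
  have key : ∀ z ∈ Φ.source, Ψ (F z) = (a (Φ z)).1 := by
    intro z hz
    have := ha (x := Φ z) (by simpa using Φ.map_source hz)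
    simpa [Φ.left_inv hz] using this
  have : FiniteDimensional ℝ (EuclideanSpace ℝ (Fin n) × C) :=
    a.toLinearEquiv.finiteDimensional
  have : FiniteDimensional ℝ C :=
    FiniteDimensional.of_surjective (LinearMap.snd ℝ (EuclideanSpace ℝ (Fin n)) C)
      LinearMap.snd_surjective
  let bN := Module.finBasis ℝ (EuclideanSpace ℝ (Fin n))
  let bC := Module.finBasis ℝ C
  let b := (bN.prod bC).map a.symm.toLinearEquiv
  obtain ⟨ρ, hρ1, -, hρΦ⟩ := exists_smooth_cutoff (E := EuclideanSpace ℝ (Fin m))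
    (Φ.open_source.mem_nhds hΦq)
  obtain ⟨χ, hχ1, -, hχΨ⟩ := exists_smooth_cutoff (E := EuclideanSpace ℝ (Fin n))
    (Ψ.open_source.mem_nhds hΨq)
  have hb : ∀ i, ContDiff ℝ ∞ fun x => b.repr x i := fun i =>
    (LinearMap.toContinuousLinearMap (b.coord i)).contDiff
  have hbN : ∀ i, ContDiff ℝ ∞ fun x => bN.repr x i := fun i =>
    (LinearMap.toContinuousLinearMap (bN.coord i)).contDiff
  let g : ∀ i, C^∞⟮𝓡 n, N; ℝ⟯ := fun i => ⟨fun x => χ x * bN.repr (Ψ x) i,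
    contMDiff_cutoff_mul χ.contMDiff Ψ.open_source hχΨ
      ((hbN i).contMDiff.comp_contMDiffOn (contMDiffOn_of_mem_maximalAtlas hΨ))⟩
  let y' : ∀ i, C^∞⟮𝓡 m, M; ℝ⟯ := fun i => ⟨fun x => ρ x * b.repr (Φ x) (Sum.inr i),
    contMDiff_cutoff_mul ρ.contMDiff Φ.open_source hρΦ
      ((hb _).contMDiff.comp_contMDiffOn (contMDiffOn_of_mem_maximalAtlas hΦ))⟩
  -- The coordinates along the base are functions on `N`; the coordinate fields along the fibres
  -- are vertical.
  let y := Sum.elim (fun i => (g i).comp F) y'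
  refine ⟨_, inferInstance, y, fun j => chartField hΦ ρ hρΦ (b j), ?_, ?_⟩
  · rintro (i | i)
    · exact Or.inr ⟨g i, rfl⟩
    · refine Or.inl fun h => ?_
      ext x
      rw [chartField_apply]
      change _ = (0 : ℝ)
      by_cases hx : x ∈ tsupport ρ
      · -- In the charts, `h ∘ F` depends on the first component only.
        have hxs := hρΦ hx
        set w := b (Sum.inr i) with hw
        have haw : (a w).1 = 0 := by simp [hw, b]
        let A : EuclideanSpace ℝ (Fin m) →L[ℝ] EuclideanSpace ℝ (Fin n) :=
          (ContinuousLinearMap.fst ℝ _ C).comp (a : _ →L[ℝ] _)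
        have hkey : ∀ z ∈ Φ.source, Ψ (F z) = A (Φ z) := key
        have h1 : ((h.comp F) ∘ Φ.symm) =ᶠ[𝓝 (Φ x)] (h ∘ Ψ.symm) ∘ A := by
          filter_upwards [Φ.open_target.mem_nhds (Φ.map_source hxs)] with t ht
          have h2 := hkey _ (Φ.map_target ht)
          rw [Φ.right_inv ht] at h2
          simp only [Function.comp_apply]
          rw [← h2, Ψ.left_inv (hsub (Φ.map_target ht))]
          rfl
        have h3 : DifferentiableAt ℝ (h ∘ Ψ.symm) (A (Φ x)) := by
          rw [← hkey x hxs]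
          exact ((contDiffOn_comp_chart_symm hΨ h).contDiffAt
            (Ψ.open_target.mem_nhds (Ψ.map_source (hsub hxs)))).differentiableAt (by simp)
        rw [h1.fderiv_eq, (h3.hasFDerivAt.comp (Φ x) A.hasFDerivAt).fderiv,
          ContinuousLinearMap.comp_apply, show A w = 0 from haw, map_zero, mul_zero]
      · rw [image_eq_zero_of_notMem_tsupport hx, zero_mul]
  · have hy : ∀ᶠ z in 𝓝 q, ∀ j, y j z = b.repr (Φ z) j := by
      filter_upwards [hρ1, F.contMDiff.continuous.continuousAt.eventually hχ1,
        Φ.open_source.mem_nhds hΦq] with z h1 h2 h3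
      rintro (i | i)
      · change χ (F z) * bN.repr (Ψ (F z)) i = _
        rw [h2, key z h3, one_mul]
        simp [b]
      · change ρ z * _ = _
        rw [h1, one_mul]
    filter_upwards [hy.eventually_nhds, hρ1, Φ.open_source.mem_nhds hΦq] with z h1 h2 h3 v hv h
    rw [hv.eq_sum hΦ h3 b (fun j => h1.mono fun x hx => hx j) h]
    simp only [chartField_apply, h2, one_mul]

end SubmersionFrames

/-! ### Evaluation at a character -/

section CharacterEval

variable {k A B L P : Type*} [CommRing k] [CommRing A] [Algebra k A] [CommRing B] [Algebra k B]
  [LieRing L] [LieAlgebra k L] [AddCommGroup P] [Module k P]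

/-- The map `A ⊗ L → P`, `a ⊗ s ↦ ε(a) π(s)`, semilinear over the character `ε` of `A`. -/
noncomputable def characterEval (ε : A →ₐ[k] k) (π : L →ₗ[k] P) :
    (A ⊗[k] L) →ₛₗ[(ε : A →+* k)] P where
  toFun := TensorProduct.lift ((LinearMap.lsmul k (L →ₗ[k] P)).flip π ∘ₗ ε.toLinearMap)
  map_add' := map_add _
  map_smul' f w := by
    induction w with
    | zero => simp
    | add x y hx hy => rw [smul_add, map_add, hx, hy, map_add, smul_add]
    | tmul g t => simp [TensorProduct.smul_tmul', mul_smul]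

variable {ε : A →ₐ[k] k} {π : L →ₗ[k] P}

@[simp]
theorem characterEval_tmul (a : A) (s : L) : characterEval ε π (a ⊗ₜ s) = ε a • π s := by
  simp [characterEval]

theorem characterEval_sum_tmul {ι : Type*} [Fintype ι] (ε : A →ₐ[k] k) (π : L →ₗ[k] P)
    (f : ι → A) (t : ι → L) :
    characterEval ε π (∑ j, f j ⊗ₜ[k] t j) = ∑ j, ε (f j) • π (t j) := by
  simp only [map_sum, characterEval_tmul]

theorem characterEval_eq_zero [Module B L] {σ : B →ₐ[k] A} {I : Ideal A}
    (hπ : ∀ (b : B) (s : L), π (b • s) = ε (σ b) • π s) (hε : ∀ a ∈ I, ε a = 0)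
    {w : A ⊗[k] L} (hw : w ∈ balancing k L σ I) : characterEval ε π w = 0 := by
  induction hw using Submodule.span_induction with
  | mem x hx =>
    rcases hx with ⟨b, t, rfl⟩ | ⟨i, hi, t, rfl⟩
    · simp [hπ]
    · simp [hε i hi]
  | zero => exact map_zero _
  | add x y _ _ hx hy => rw [map_add, hx, hy, add_zero]
  | smul a x _ hx => rw [map_smulₛₗ, hx, smul_zero]

/-- Two-step evaluation: the image under `T` of the value of `∑ f i ⊗ y i` is the value of what is
obtained on replacing each `y i` by an element `z i` that represents its image under `T`. -/
theorem characterEval_sum_coeffMap {P' ι : Type*} [AddCommGroup P'] [Module k P'] [Fintype ι]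
    {L' : Type*} [LieRing L'] [LieAlgebra k L'] {σ : B →ₐ[k] A} {π' : L' →ₗ[k] P'} (T : P →ₗ[k] P')
    {ε' : B →ₐ[k] k} (hε : ε.comp σ = ε') {f : ι → A} {y : ι → L} {z : ι → B ⊗[k] L'}
    (h : ∀ i, T (π (y i)) = characterEval ε' π' (z i)) :
    T (characterEval ε π (∑ i, f i ⊗ₜ[k] y i)) =
      characterEval ε π' (∑ i, f i • coeffMap L' σ (z i)) := by
  subst hε
  have h1 : ∀ z : B ⊗[k] L', characterEval ε π' (coeffMap L' σ z) =
      characterEval (ε.comp σ) π' z := by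
    intro z
    induction z with
    | zero => simp
    | add x y hx hy => simp only [map_add, hx, hy]
    | tmul b s => simp
  simp only [map_sum, characterEval_tmul, map_smulₛₗ, h, h1]
  rfl

/-- The map on the quotient by `J S` induced by a map from `S` that is semilinear over a character
with kernel containing `J`. -/
noncomputable def characterQuotient {S : Type*} [AddCommGroup S] [Module A S] [Module k S]
    [IsScalarTower k A S] {J : Ideal A} (Λ : S →ₛₗ[(ε : A →+* k)] P) (hJ : ∀ a ∈ J, ε a = 0) :
    (S ⧸ (J • (⊤ : Submodule A S))) →ₗ[k] P :=
  let Λ' : (S ⧸ (J • (⊤ : Submodule A S))) →ₛₗ[(ε : A →+* k)] P :=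
    Submodule.liftQ _ Λ (Submodule.smul_le.mpr fun f hf x _ => by
      rw [LinearMap.mem_ker, map_smulₛₗ, show (ε : A →+* k) f = 0 from hJ f hf, zero_smul])
  { toFun := Λ'
    map_add' := map_add Λ'
    map_smul' := fun c x => by
      rw [← algebraMap_smul A c x, map_smulₛₗ]
      simp }

namespace AdaptedFrame

variable {𝔤 M 𝔥 N : Type*}
  [LieRing 𝔤] [Module A 𝔤] [LieRingModule 𝔤 A] [LieRinehartRing A 𝔤]
  [LieAlgebra k 𝔤] [LieRinehartAlgebra k A 𝔤]
  [AddCommGroup M] [Module A M] [LieRingModule 𝔤 M] [AnchoredModule k A 𝔤 M]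
  [LieRing 𝔥] [Module B 𝔥] [LieRingModule 𝔥 B] [LieRinehartRing B 𝔥]
  [LieAlgebra k 𝔥] [LieRinehartAlgebra k B 𝔥]
  [AddCommGroup N] [Module B N] [LieRingModule 𝔥 N] [AnchoredModule k B 𝔥 N]
  {σ : B →ₐ[k] A} {I : Ideal A} (fr : AdaptedFrame k 𝔤 M 𝔥 N σ I)
  (hI : ∀ D : Derivation k A A, ∀ a ∈ I, D a ∈ I) {π : RelFree k B 𝔥 N →ₗ[k] P}

/-- The image under `transport`, evaluated by `ε ⊗ π`. -/
noncomputable def transportEval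
    (hπ : ∀ (b : B) (s : RelFree k B 𝔥 N), π (b • s) = ε (σ b) • π s) (hε : ∀ a ∈ I, ε a = 0) :
    RelFree k A 𝔤 M →ₛₗ[(ε : A →+* k)] P :=
  (Submodule.liftQ (balancing k (RelFree k B 𝔥 N) σ I) (characterEval ε π)
    fun _ hw => characterEval_eq_zero hπ hε hw).comp (fr.transport hI)

variable {fr hI}

theorem Represents.transportEval_eq (hπ : ∀ (b : B) (s : RelFree k B 𝔥 N),
    π (b • s) = ε (σ b) • π s) (hε : ∀ a ∈ I, ε a = 0) {x : RelFree k A 𝔤 M}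
    {w : A ⊗[k] RelFree k B 𝔥 N} (h : fr.Represents hI x w) :
    fr.transportEval hI hπ hε x = characterEval ε π w := by
  rw [transportEval, LinearMap.comp_apply, h]
  rfl

theorem exists_characterEval_eq_of_mem_filtSpan (ε : A →ₐ[k] k) {d : ℕ}
    {w : A ⊗[k] RelFree k B 𝔥 N} (hw : w ∈ filtSpan k A 𝔥 N d) :
    ∃ y : RelFree k B 𝔥 N, RelFree.FiltLE k B 𝔥 N d y ∧ characterEval ε π w = π y := by
  induction hw using Submodule.span_induction with
  | mem w hw =>
    obtain ⟨y, hy, rfl⟩ := hw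
    exact ⟨y, hy, by simp⟩
  | zero => exact ⟨0, .zero, by simp⟩
  | add w w' _ _ hw hw' =>
    obtain ⟨y, hy, h⟩ := hw
    obtain ⟨y', hy', h'⟩ := hw'
    exact ⟨y + y', hy.add hy', by simp [h, h']⟩
  | smul a w _ hw =>
    obtain ⟨y, hy, h⟩ := hw
    exact ⟨algebraMap k B (ε a) • y, hy.smul _, by simp [h]⟩

variable (fr) in
/-- Evaluated at a character, the pushforward of `m` depends only on the values of the anchor
of `m`. -/
theorem characterEval_pushforward
    (hπ : ∀ (b : B) (s : RelFree k B 𝔥 N), π (b • s) = ε (σ b) • π s) (hε : ∀ a ∈ I, ε a = 0)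
    {m : M} {η : N} (h : ∀ b, ε (AnchoredModule.anchor (k := k) 𝔤 m (σ b)) =
      ε (σ (AnchoredModule.anchor (k := k) 𝔥 η b))) :
    characterEval ε π (fr.pushforward m) = π (RelFree.of k B 𝔥 N η) := by
  have h1 := characterEval_eq_zero hπ hε (fr.tmul_of_sub_mem 1 η)
  rw [map_sub, sub_eq_zero, characterEval_tmul, map_one, one_smul] at h1
  rw [h1]
  simp [pushforward, h]

end AdaptedFrame

end CharacterEval

/-! ### Fibres of the bundle of infinitesimal paths -/

section Fibres

variable {m n m' : ℕ}
  {M : Type*} [TopologicalSpace M] [ChartedSpace (EuclideanSpace ℝ (Fin m)) M]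
  {N : Type*} [TopologicalSpace N] [ChartedSpace (EuclideanSpace ℝ (Fin n)) N]
  {M' : Type*} [TopologicalSpace M'] [ChartedSpace (EuclideanSpace ℝ (Fin m')) M']

/-- Composition with `φ`, as a homomorphism of algebras of smooth functions. -/
noncomputable def pullbackHom (φ : C^∞⟮𝓡 m, M; 𝓡 m', M'⟯) :
    C^∞⟮𝓡 m', M'; ℝ⟯ →ₐ[ℝ] C^∞⟮𝓡 m, M; ℝ⟯ where
  toFun h := h.comp φ
  map_one' := rfl
  map_mul' _ _ := rfl
  map_zero' := rfl
  map_add' _ _ := rfl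
  commutes' _ := rfl

theorem smul_at {F : C^∞⟮𝓡 m, M; 𝓡 n, N⟯} (f : C^∞⟮𝓡 m, M; ℝ⟯) (t : PathSections F) (p : M) :
    (f • t).at p = f p • t.at p := by
  have h : f - algebraMap ℝ C^∞⟮𝓡 m, M; ℝ⟯ (f p) ∈ vanishingAt m p := by
    change f p - f p = (0 : ℝ)
    exact sub_self _
  have e : f p • t.at p = (algebraMap ℝ C^∞⟮𝓡 m, M; ℝ⟯ (f p) • t).at p := rfl
  rw [e]
  refine (Submodule.Quotient.eq _).mpr ?_
  rw [← sub_smul]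
  exact Submodule.smul_mem_smul h trivial

/-- Evaluation at a point, as a homomorphism of algebras. -/
noncomputable def pointEval (m : ℕ) {M : Type*} [TopologicalSpace M]
    [ChartedSpace (EuclideanSpace ℝ (Fin m)) M] (p : M) : C^∞⟮𝓡 m, M; ℝ⟯ →ₐ[ℝ] ℝ where
  toRingHom := ContMDiffMap.evalRingHom (I := 𝓡 m) (I' := 𝓘(ℝ, ℝ)) (n := ∞) (R := ℝ) p
  commutes' _ := rfl

/-- Taking the value at `p`, as a linear map. -/
noncomputable def PathSections.atLinear (F : C^∞⟮𝓡 m, M; 𝓡 n, N⟯) (p : M) :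
    PathSections F →ₗ[ℝ] PathFibre F p where
  toFun s := s.at p
  map_add' _ _ := rfl
  map_smul' _ _ := rfl

theorem PathSections.atLinear_apply (F : C^∞⟮𝓡 m, M; 𝓡 n, N⟯) (p : M) (s : PathSections F) :
    PathSections.atLinear F p s = s.at p := rfl

end Fibres

/-- Frames for a square at a point `p` of its source, modulo germs of functions at `p`. -/
abbrev BundleSquare.Frame {X Y : LocTrivBundle.{u, v}} (s : BundleSquare X Y) (p : X.total) :=
  AdaptedFrame ℝ (verticalFields X.proj) (SmoothVectorField X.dimTotal X.total)
    (verticalFields Y.proj) (SmoothVectorField Y.dimTotal Y.total) (pullbackHom s.top)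
    (germIdeal (EuclideanSpace ℝ (Fin X.dimTotal)) p)

section SumApply

variable {m : ℕ} {M : Type*} [TopologicalSpace M] [ChartedSpace (EuclideanSpace ℝ (Fin m)) M]

theorem contMDiffMap_sum_apply {ι : Type*} [Fintype ι] (f : ι → C^∞⟮𝓡 m, M; ℝ⟯) (z : M) :
    (∑ j, f j) z = ∑ j, f j z :=
  map_sum (pointEval m z) f _

theorem SmoothVectorField.sum_smul_apply {ι : Type*} [Fintype ι] (f : ι → C^∞⟮𝓡 m, M; ℝ⟯)
    (e : ι → SmoothVectorField m M) (h : C^∞⟮𝓡 m, M; ℝ⟯) (z : M) :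
    (∑ j, f j • e j) h z = ∑ j, f j z * e j h z := by
  have h1 : (∑ j, f j • e j) h = ∑ j, f j * e j h := by
    classical
    induction (Finset.univ : Finset ι) using Finset.induction_on with
    | empty => rfl
    | insert a s ha ih =>
      rw [Finset.sum_insert ha, Finset.sum_insert ha, Derivation.add_apply, ih]
      rfl
  rw [h1, contMDiffMap_sum_apply]
  rfl

end SumApply

section PointDerivations

variable {m n : ℕ} {M : Type*} [TopologicalSpace M] [ChartedSpace (EuclideanSpace ℝ (Fin m)) M]
  {N : Type*} [TopologicalSpace N] [ChartedSpace (EuclideanSpace ℝ (Fin n)) N]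

/-- The image under the differential of `φ` at `z` of the value of the vector field `ξ`. -/
noncomputable def SmoothVectorField.push (φ : C^∞⟮𝓡 m, M; 𝓡 n, N⟯) (ξ : SmoothVectorField m M)
    (z : M) : C^∞⟮𝓡 n, N; ℝ⟯ →ₗ[ℝ] ℝ where
  toFun h := ξ (h.comp φ) z
  map_add' f g := by
    change ξ (f.comp φ + g.comp φ) z = _
    rw [map_add]
    rfl
  map_smul' c f := by
    change ξ (c • f.comp φ) z = _
    rw [Derivation.map_smul]
    rfl

theorem SmoothVectorField.isPointDerivation_push (φ : C^∞⟮𝓡 m, M; 𝓡 n, N⟯)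
    (ξ : SmoothVectorField m M) (z : M) : IsPointDerivation (φ z) (ξ.push φ z) := by
  intro f g
  change ξ (f.comp φ * g.comp φ) z = _
  rw [Derivation.leibniz]
  rfl

end PointDerivations

/-- Coordinates of the target adapted to its projection give a frame. It is adapted, since a
vertical field of the source annihilates the functions that are pulled back from the base of the
target, as the square commutes. -/
theorem BundleSquare.nonempty_frame {X Y : LocTrivBundle.{u, v}} (s : BundleSquare X Y)
    (p : X.total) : Nonempty (s.Frame p) := by
  obtain ⟨ι, _, y, e, hye, hU⟩ := exists_adapted_coordinates Y.locTriv (s.top p)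
  refine ⟨⟨ι, y, e, fun η => ?_, fun ξ b => ?_, fun j => ?_⟩⟩
  · obtain ⟨χ, hχ1, -, hχU⟩ := exists_smooth_cutoff (E := EuclideanSpace ℝ (Fin Y.dimTotal)) hU
    refine ⟨χ, ?_, ?_⟩
    · filter_upwards [s.top.contMDiff.continuous.continuousAt.eventually hχ1] with z hz
      change 1 - χ (s.top z) = (0 : ℝ)
      rw [hz, sub_self]
    · refine Derivation.ext fun h => ?_
      ext z
      rw [Derivation.smul_apply, Derivation.smul_apply]
      change χ z * η h z = χ z * _
      by_cases hz : z ∈ tsupport χ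
      · congr 1
        exact (hχU hz _ (SmoothVectorField.isPointDerivation_push ContMDiffMap.id η z) h).trans
          (SmoothVectorField.sum_smul_apply _ _ _ _).symm
      · rw [image_eq_zero_of_notMem_tsupport hz, zero_mul, zero_mul]
  · filter_upwards [s.top.contMDiff.continuous.continuousAt.eventually hU] with z hz
    change ξ (b.comp s.top) z - (∑ j, _ : C^∞⟮𝓡 X.dimTotal, X.total; ℝ⟯) z = 0
    rw [contMDiffMap_sum_apply, sub_eq_zero]
    exact hz _ (SmoothVectorField.isPointDerivation_push s.top ξ z) b
  · rcases hye j with h | ⟨g, hg⟩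
    · exact Or.inl ⟨⟨e j, h⟩, rfl⟩
    · refine Or.inr fun γ => ?_
      have h1 : pullbackHom s.top (y j) = (g.comp s.bot).comp X.proj := by
        rw [hg]
        change g.comp (Y.proj.comp s.top) = g.comp (s.bot.comp X.proj)
        rw [s.comm]
      rw [h1]
      exact γ.2 _

/-! ### The map induced by a square -/

namespace BundleSquare

variable {X Y Z : LocTrivBundle.{u, v}}

/-- A frame at the image of `p`. The maps below do not depend on this choice. -/
noncomputable def frame (s : BundleSquare X Y) (p : X.total) : s.Frame p :=
  (s.nonempty_frame p).some

/-- The germ at `p` of the image of the section `x` under the square `s` is represented by `w`, a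
section of the pullback of the bundle of infinitesimal paths of `Y`. -/
def Represents (s : BundleSquare X Y) (p : X.total) (x : PathSections X.proj)
    (w : C^∞⟮𝓡 X.dimTotal, X.total; ℝ⟯ ⊗[ℝ] PathSections Y.proj) : Prop :=
  (s.frame p).Represents (fun D _ => D.apply_mem_germIdeal) x w

theorem atLinear_smul (s : BundleSquare X Y) (p : X.total) (b : C^∞⟮𝓡 Y.dimTotal, Y.total; ℝ⟯)
    (t : PathSections Y.proj) : PathSections.atLinear Y.proj (s.top p) (b • t) =
      pointEval X.dimTotal p (pullbackHom s.top b) • PathSections.atLinear Y.proj (s.top p) t :=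
  smul_at b t (s.top p)

theorem pointEval_eq_zero (p : X.total) (a : C^∞⟮𝓡 X.dimTotal, X.total; ℝ⟯)
    (ha : a ∈ germIdeal (EuclideanSpace ℝ (Fin X.dimTotal)) p) : pointEval X.dimTotal p a = 0 :=
  (show ∀ᶠ z in 𝓝 p, a z = 0 from ha).self_of_nhds

/-- The map that a square induces on sections, evaluated at a point. -/
noncomputable def sectionMap (s : BundleSquare X Y) (p : X.total) :
    PathSections X.proj →ₛₗ[(pointEval X.dimTotal p : C^∞⟮𝓡 X.dimTotal, X.total; ℝ⟯ →+* ℝ)]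
      PathFibre Y.proj (s.top p) :=
  (s.frame p).transportEval (fun D _ => D.apply_mem_germIdeal) (ε := pointEval X.dimTotal p)
    (π := PathSections.atLinear Y.proj (s.top p)) (s.atLinear_smul p) (pointEval_eq_zero p)

/-- The fibrewise linear map that a square induces on bundles of infinitesimal paths. -/
noncomputable def pathMap (s : BundleSquare X Y) : FibrewiseLinearMap s := fun p =>
  characterQuotient (s.sectionMap p) fun _ hf => hf

theorem Represents.pathMap_eq {s : BundleSquare X Y} {p : X.total} {x : PathSections X.proj}
    {w : C^∞⟮𝓡 X.dimTotal, X.total; ℝ⟯ ⊗[ℝ] PathSections Y.proj} (h : s.Represents p x w) :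
    s.pathMap p (x.at p) = characterEval (pointEval X.dimTotal p)
      (PathSections.atLinear Y.proj (s.top p)) w :=
  AdaptedFrame.Represents.transportEval_eq (s.atLinear_smul p) (pointEval_eq_zero p) h

theorem pathMap_one_tmul {s : BundleSquare X Y} {p : X.total} {x : PathSections X.proj}
    {y : PathSections Y.proj} (h : s.Represents p x (1 ⊗ₜ y)) :
    s.pathMap p (x.at p) = y.at (s.top p) := by
  rw [h.pathMap_eq, characterEval_tmul, map_one, one_smul, PathSections.atLinear_apply]

end BundleSquare

/-! ### Naturality and functoriality -/

namespace BundleSquare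

variable {X Y Z : LocTrivBundle.{u, v}}

theorem pathMap_filt (s : BundleSquare X Y) (d : ℕ) :
    Set.MapsTo s.pathMap.toFun (PathBundle.filt X.proj d) (PathBundle.filt Y.proj d) := by
  rintro ⟨p, v⟩ ⟨x, hx, hv⟩
  obtain rfl : v = x.at p := hv
  obtain ⟨w, hw, h⟩ := AdaptedFrame.exists_represents_of_filtLE (fr := s.frame p)
    (hI := fun D _ => D.apply_mem_germIdeal) hx
  obtain ⟨y, hy, h'⟩ := AdaptedFrame.exists_characterEval_eq_of_mem_filtSpan
    (pointEval X.dimTotal p) (π := PathSections.atLinear Y.proj (s.top p)) hw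
  exact ⟨y, hy, (Represents.pathMap_eq h).trans h'⟩

theorem pathMap_field (s : BundleSquare X Y) (p : X.total)
    (ξ : SmoothVectorField X.dimTotal X.total) (η : SmoothVectorField Y.dimTotal Y.total)
    (h : ∀ g : C^∞⟮𝓡 Y.dimTotal, Y.total; ℝ⟯, ξ (g.comp s.top) p = η g (s.top p)) :
    s.pathMap p ((PathSections.ofField X.proj ξ).at p) =
      (PathSections.ofField Y.proj η).at (s.top p) := by
  have h1 : s.Represents p (PathSections.ofField X.proj ξ) ((s.frame p).pushforward ξ) :=
    .of ((s.frame p).pushforward_mem ξ) ((s.frame p).compatible_pushforward ξ)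
  exact h1.pathMap_eq.trans ((s.frame p).characterEval_pushforward (s.atLinear_smul p)
    (pointEval_eq_zero p) h)

theorem pathMap_bracket (s : BundleSquare X Y) (p : X.total) (k : ℕ)
    (ξ : Fin k → SmoothVectorField X.dimTotal X.total)
    (η : Fin k → SmoothVectorField Y.dimTotal Y.total)
    (h : ∀ i, ∀ᶠ q in 𝓝 p, ∀ g : C^∞⟮𝓡 Y.dimTotal, Y.total; ℝ⟯,
      ξ i (g.comp s.top) q = η i g (s.top q)) (w : FreeLieAlgebra ℝ (Fin k)) :
    s.pathMap p ((FreeLieAlgebra.lift ℝ (fun i => PathSections.ofField X.proj (ξ i)) w).at p) =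
      (FreeLieAlgebra.lift ℝ (fun i => PathSections.ofField Y.proj (η i)) w).at (s.top p) := by
  refine pathMap_one_tmul (AdaptedFrame.represents_lift (fun i g => ?_) w)
  filter_upwards [h i] with z hz
  exact sub_eq_zero.mpr (hz g)

theorem isInduced_pathMap (s : BundleSquare X Y) : s.pathMap.IsInduced :=
  ⟨s.pathMap_filt, s.pathMap_field, s.pathMap_bracket⟩

/-- Near each point, one section of the pullback bundle represents the image of `x`, although the
frames vary from point to point. -/
theorem exists_eventually_represents (s : BundleSquare X Y) (p₀ : X.total)
    (x : PathSections X.proj) : ∃ w, ∀ᶠ p in 𝓝 p₀, s.Represents p x w := by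
  refine AdaptedFrame.exists_eventually_represents (fun ξ => ?_) x
  obtain ⟨ι, _, y, e, -, hU⟩ := exists_adapted_coordinates Y.locTriv (s.top p₀)
  refine ⟨∑ j, ξ ((y j).comp s.top) ⊗ₜ RelFree.of _ _ _ _ (e j),
    Submodule.sum_mem _ fun j _ => tmul_of_mem_generatorSpan _ _, ?_⟩
  have hU' := (s.top.contMDiff.continuous.continuousAt.eventually hU).eventually_nhds
  refine hU'.mono fun p hp b => ?_
  filter_upwards [hp] with z hz
  rw [map_sum]
  change ξ (b.comp s.top) z - (∑ j, _ : C^∞⟮𝓡 X.dimTotal, X.total; ℝ⟯) z = 0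
  rw [contMDiffMap_sum_apply, sub_eq_zero]
  refine (hz _ (SmoothVectorField.isPointDerivation_push s.top ξ z) b).trans
    (Finset.sum_congr rfl fun j _ => ?_)
  rw [pullAnchor_tmul]
  rfl

theorem represents_id (p : X.total) (x : PathSections X.proj) :
    (BundleSquare.id X).Represents p x (1 ⊗ₜ x) :=
  AdaptedFrame.represents_id (fr := (BundleSquare.id X).frame p) (fun _ => rfl) x

theorem pathMap_toFun_id (X : LocTrivBundle.{u, v}) :
    (BundleSquare.id X).pathMap.toFun = _root_.id := by
  funext ⟨p, v⟩
  obtain ⟨x, rfl⟩ : ∃ x : PathSections X.proj, x.at p = v := Submodule.Quotient.mk_surjective _ v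
  have h := (represents_id p x).pathMap_eq
  have h2 := characterEval_tmul (ε := pointEval X.dimTotal p)
    (π := PathSections.atLinear X.proj p) 1 x
  have h3 : pointEval X.dimTotal p 1 • PathSections.atLinear X.proj p x = x.at p := by
    rw [map_one, one_smul, PathSections.atLinear_apply]
  exact congrArg (PathBundle.mk p) (h.trans (h2.trans h3))

theorem pullbackHom_comp (t : BundleSquare Y Z) (s : BundleSquare X Y) :
    pullbackHom (t.comp s).top = (pullbackHom s.top).comp (pullbackHom t.top) := rfl

theorem pullbackHom_mem_germIdeal (s : BundleSquare X Y) (p : X.total)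
    (b) (hb : b ∈ germIdeal (EuclideanSpace ℝ (Fin Y.dimTotal)) (s.top p)) :
    pullbackHom s.top b ∈ germIdeal (EuclideanSpace ℝ (Fin X.dimTotal)) p :=
  s.top.contMDiff.continuous.continuousAt.eventually hb

theorem exists_represents_comp (t : BundleSquare Y Z) (s : BundleSquare X Y) (p : X.total)
    (x : PathSections X.proj) :
    ∃ (ι : Type) (_ : Fintype ι) (f : ι → C^∞⟮𝓡 X.dimTotal, X.total; ℝ⟯)
      (y : ι → PathSections Y.proj)
      (z : ι → C^∞⟮𝓡 Y.dimTotal, Y.total; ℝ⟯ ⊗[ℝ] PathSections Z.proj),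
      s.Represents p x (∑ i, f i ⊗ₜ[ℝ] y i) ∧ (∀ i, t.Represents (s.top p) (y i) (z i)) ∧
        (t.comp s).Represents p x (∑ i, f i • coeffMap _ (pullbackHom s.top) (z i)) := 
  AdaptedFrame.exists_represents_comp (fr := s.frame p) (fr' := t.frame (s.top p))
    (frc := (t.comp s).frame p) (pullbackHom_comp t s) (s.pullbackHom_mem_germIdeal p) x

theorem pointEval_comp_pullbackHom (s : BundleSquare X Y) (p : X.total) :
    (pointEval X.dimTotal p).comp (pullbackHom s.top) = pointEval Y.dimTotal (s.top p) := rfl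

theorem pathMap_toFun_comp (t : BundleSquare Y Z) (s : BundleSquare X Y) :
    (t.comp s).pathMap.toFun = t.pathMap.toFun ∘ s.pathMap.toFun := by
  funext ⟨p, v⟩
  obtain ⟨x, rfl⟩ : ∃ x : PathSections X.proj, x.at p = v := Submodule.Quotient.mk_surjective _ v
  obtain ⟨ι, _, f, y, z, h1, h2, h3⟩ := exists_represents_comp t s p x
  have e1 := h1.pathMap_eq
  have e3 := h3.pathMap_eq
  have e := characterEval_sum_coeffMap (ε := pointEval X.dimTotal p)
    (π := PathSections.atLinear Y.proj (s.top p)) (σ := pullbackHom s.top) (f := f) (y := y)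
    (z := z) (π' := PathSections.atLinear Z.proj (t.top (s.top p))) (t.pathMap (s.top p))
    (pointEval_comp_pullbackHom s p) fun i => (h2 i).pathMap_eq
  exact congrArg (PathBundle.mk (t.top (s.top p)))
    (e3.trans (e.symm.trans (congrArg (t.pathMap (s.top p)) e1.symm)))

end BundleSquare

/-! ### Smoothness -/

theorem exists_eq_sum_tmul {R A L : Type*} [CommSemiring R] [AddCommMonoid A] [Module R A]
    [AddCommMonoid L] [Module R L] (w : A ⊗[R] L) :
    ∃ (r : ℕ) (f : Fin r → A) (t : Fin r → L), w = ∑ j, f j ⊗ₜ t j := by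
  obtain ⟨S, hS⟩ := TensorProduct.exists_finset w
  refine ⟨S.card, fun j => (S.equivFin.symm j).1.1, fun j => (S.equivFin.symm j).1.2, ?_⟩
  rw [hS, ← Finset.sum_coe_sort S]
  exact (S.equivFin.symm.sum_comp fun i : S => i.1.1 ⊗ₜ[R] i.1.2).symm

/-- A linear map applied to a combination of vectors whose images are themselves combinations,
written as a single sum. -/
theorem LinearMap.apply_eq_sum_equivFin {k P P' : Type*} [CommSemiring k] [AddCommMonoid P]
    [Module k P] [AddCommMonoid P'] [Module k P'] (T : P →ₗ[k] P') {r : ℕ} {q : Fin r → ℕ} {v : P}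
    {g : Fin r → k} {x : Fin r → P} {b : ∀ i, Fin (q i) → k} {y : ∀ i, Fin (q i) → P'}
    (hv : v = ∑ i, g i • x i) (hT : ∀ i, T (x i) = ∑ j, b i j • y i j)
    {N : ℕ} (e : (Σ i, Fin (q i)) ≃ Fin N) :
    T v = ∑ a, (g (e.symm a).1 * b _ (e.symm a).2) • y _ (e.symm a).2 := by
  rw [e.symm.sum_comp fun a : Σ i, Fin (q i) => (g a.1 * b _ a.2) • y _ a.2, Fintype.sum_sigma, hv,
    map_sum]
  refine Finset.sum_congr rfl fun i _ => ?_
  rw [map_smul, hT, Finset.smul_sum]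
  exact Finset.sum_congr rfl fun j _ => smul_smul _ _ _

namespace BundleSquare

variable {X Y Z : LocTrivBundle.{u, v}}

theorem Represents.pathMap_eq_sum {s : BundleSquare X Y} {p : X.total} {x : PathSections X.proj}
    {r : ℕ} {f : Fin r → C^∞⟮𝓡 X.dimTotal, X.total; ℝ⟯} {t : Fin r → PathSections Y.proj}
    (h : s.Represents p x (∑ j, f j ⊗ₜ[ℝ] t j)) :
    s.pathMap p (x.at p) = ∑ j, f j p • (t j).at (s.top p) :=
  h.pathMap_eq.trans (characterEval_sum_tmul (pointEval X.dimTotal p)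
    (PathSections.atLinear Y.proj (s.top p)) f t)

theorem exists_eventually_represents_sum (s : BundleSquare X Y) (p₀ : X.total)
    (x : PathSections X.proj) : ∃ (r : ℕ) (f : Fin r → C^∞⟮𝓡 X.dimTotal, X.total; ℝ⟯)
      (t : Fin r → PathSections Y.proj),
      ∀ᶠ p in 𝓝 p₀, s.Represents p x (∑ j, f j ⊗ₜ[ℝ] t j) := by
  obtain ⟨w, hw⟩ := s.exists_eventually_represents p₀ x
  obtain ⟨r, f, t, rfl⟩ := exists_eq_sum_tmul w
  exact ⟨r, f, t, hw⟩

/-- Near each point, the image of a section is a finite combination of sections with smooth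
coefficients. -/
theorem exists_eventually_pathMap_eq_sum (s : BundleSquare X Y) (p₀ : X.total)
    (x : PathSections X.proj) : ∃ (r : ℕ) (f : Fin r → C^∞⟮𝓡 X.dimTotal, X.total; ℝ⟯)
      (t : Fin r → PathSections Y.proj),
      ∀ᶠ p in 𝓝 p₀, s.pathMap p (x.at p) = ∑ j, f j p • (t j).at (s.top p) :=
  (s.exists_eventually_represents_sum p₀ x).imp fun _ => Exists.imp fun _ => Exists.imp fun _ h =>
    h.mono fun _ hp => hp.pathMap_eq_sum

/-- The coefficients of the image of a smooth family are products of the coefficients of the family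
with smooth functions on the source, pulled back to the parameter space. -/
theorem dSmooth_pathMap (s : BundleSquare X Y) : Diffeology.DSmooth s.pathMap.toFun := by
  intro k c hc
  obtain ⟨h1, h2⟩ : PathBundle.SmoothOn c Set.univ := hc
  change PathBundle.SmoothOn (s.pathMap.toFun ∘ c) Set.univ
  refine ⟨s.top.contMDiff.comp_contMDiffOn h1, fun u₀ _ => ?_⟩
  obtain ⟨V, hV, hu₀, -, r, g, x, hg, hc⟩ := h2 u₀ trivial
  choose q f t hft using fun i => s.exists_eventually_pathMap_eq_sum (c u₀).base (x i)
  have hcont : Continuous fun u => (c u).base :=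
    (contMDiffOn_univ.mp h1).continuous
  obtain ⟨W, hWsub, hW, hu₀W⟩ := mem_nhds_iff.mp
    (hcont.continuousAt.eventually (Filter.eventually_all.mpr hft))
  let e := Fintype.equivFin (Σ i, Fin (q i))
  refine ⟨V ∩ W, hV.inter hW, ⟨hu₀, hu₀W⟩, Set.subset_univ _, _,
    fun a u => g (e.symm a).1 u * f _ (e.symm a).2 (c u).base, fun a => t _ (e.symm a).2,
    fun a => ?_, fun u hu => ?_⟩
  · have h3 : ContMDiff (𝓡 k) 𝓘(ℝ, ℝ) ∞ fun u => f _ (e.symm a).2 (c u).base :=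
      (f _ (e.symm a).2).contMDiff.comp (contMDiffOn_univ.mp h1)
    exact ((hg _).mono Set.inter_subset_left).mul h3.contDiff.contDiffOn
  · exact (s.pathMap (c u).base).apply_eq_sum_equivFin (hc u hu.1) (hWsub hu.2) e

end BundleSquare

theorem mainTheorem3 :
    ∃ RT : ∀ {X Y : LocTrivBundle.{u, v}} (s : BundleSquare X Y), FibrewiseLinearMap s,
      (∀ (X Y : LocTrivBundle.{u, v}) (s : BundleSquare X Y),
        (RT s).IsInduced ∧ Diffeology.DSmooth (RT s).toFun) ∧
      (∀ X : LocTrivBundle.{u, v}, (RT (BundleSquare.id X)).toFun = id) ∧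
      (∀ (X Y Z : LocTrivBundle.{u, v}) (t : BundleSquare Y Z) (s : BundleSquare X Y),
        (RT (t.comp s)).toFun = (RT t).toFun ∘ (RT s).toFun) := by
  exact ⟨fun s => s.pathMap, fun X Y s => ⟨s.isInduced_pathMap, s.dSmooth_pathMap⟩,
    BundleSquare.pathMap_toFun_id, fun X Y Z t s => t.pathMap_toFun_comp s⟩
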